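/- **Conventions.** A *Hermitian manifold* $\mathcal M=(M,g,\mathcal J)$ of real dimension $2n$ is a smooth manifold $M$ with a smooth Riemannian metric $g$ and a smooth almost complex structure $\mathcal J$ such that $\mathcal J^*g=g$ and $\mathcal J$ is integrable, i.e. near every point of $M$ there are holomorphic coordinates: smooth coordinates $z=(z_1,\dots,z_n)$, $z_a=x_a+\sqrt{-1}\,y_a$, with $\mathcal J\partial_{x_a}=\partial_{y_a}$ and $\mathcal J\partial_{y_a}=-\partial_{x_a}$. Its Kähler form is $\Omega(x,y):=g(x,\mathcal Jy)$, and its curvature tensor is $R(x,y,z,w):=g\big((\nabla_x\nabla_y-\nabla_y\nabla_x-\nabla_{[x,y]})z,w\big)$ with $\nabla$ the Levi-Civita connection. Let $V$ be a real vector space of dimension $2n$ with a positive definite inner product $\langle\cdot,\cdot\rangle$ and a linear map $J$ with $J^2=-\mathrm{id}$ and $\langle Jx,Jy\rangle=\langle x,y\rangle$. Let $\mathfrak A\subset\otimes^4V^*$ be the space of all $A$ with $$A(x,y,z,w)=-A(y,x,z,w)=A(z,w,x,y),\qquad A(x,y,z,w)+A(y,z,x,w)+A(z,x,y,w)=0 .$$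 Let $S^2(V^*)$ be the space of symmetric bilinear forms on $V$ and $S^2_+(V^*)$ the subspace of those $\theta$ with $\theta(Jx,Jy)=\theta(x,y)$. Define the linear map $\mathcal L:S^2_+(V^*)\otimes S^2(V^*)\to\mathfrak A$ by $$\mathcal L(\Theta)(x,y,z,w):=\Theta(x,z,y,w)+\Theta(y,w,x,z)-\Theta(x,w,y,z)-\Theta(y,z,x,w),$$ and let $\mathfrak L:=\operatorname{Range}(\mathcal L)$. For $A\in\mathfrak A$, the model $(V,\langle\cdot,\cdot\rangle,J,A)$ is *geometrically realized* by $\mathcal M$ at $P\in M$ if there is a linear isomorphism $\phi:V\to T_PM$ with $\langle\cdot,\cdot\rangle=\phi^*g_P$, $J=\phi^*\mathcal J_P$ and $A=\phi^*R_P$. **Lemma 2.3.** 1. Let $\mathcal M=(M,g,\mathcal J)$ be a Hermitian manifold of real dimension $2n$ and let $P\in M$. Then $d\Omega(P)=0$ if and only if there exist holomorphic coordinates $z=(z_1,\dots,z_n)$ near $P$ with $z(P)=0$ in which $g=\delta+O(|z|^2)$ as $z\to0$, i.e. in the real coordinates $(u_1,\dots,u_{2n})=(x_1,\dots,x_n,y_1,\dots,y_n)$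 one has $g(\partial_{u_i},\partial_{u_j})=\delta_{ij}+O(|z|^2)$ for all $i,j$. 2. Let $A\in\mathfrak A$. Then $A\in\mathfrak L$ if and only if there are a Hermitian manifold $\mathcal M$ and a point $P$ of $\mathcal M$ with $d\Omega(P)=0$ such that the model $(V,\langle\cdot,\cdot\rangle,J,A)$ is geometrically realized by $\mathcal M$ at $P$. -/

import Mathlib

open scoped Manifold ContDiff Topology

noncomputable section

namespace HermitianCurvature

/-! ### Curvature models -/

section Algebra

variable {V : Type*} [NormedAddCommGroup V] [InnerProductSpace ℝ V]

variable (V) in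
/-- The space `⊗⁴ V*` of real 4-tensors on `V`; the value at `(x, y, z, w)` is `A ![x, y, z, w]`. -/
abbrev Tensor4 : Type _ := MultilinearMap ℝ (fun _ : Fin 4 => V) ℝ

variable (V) in
/-- A Hermitian complex structure on `(V, ⟨·,·⟩)`: `J² = -id` and `J^*⟨·,·⟩ = ⟨·,·⟩`. -/
structure HermitianComplexStructure where
  J : V →ₗ[ℝ] V
  sq : ∀ x, J (J x) = -x
  isometry : ∀ x y, inner ℝ (J x) (J y) = inner ℝ x y

variable (V) in
/-- The space `𝔄` of algebraic curvature tensors. -/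
def algCurv : Submodule ℝ (Tensor4 V) where
  carrier := {A | (∀ x y z w, A ![x, y, z, w] = -A ![y, x, z, w]) ∧
    (∀ x y z w, A ![x, y, z, w] = A ![z, w, x, y]) ∧
    (∀ x y z w, A ![x, y, z, w] + A ![y, z, x, w] + A ![z, x, y, w] = 0)}
  zero_mem' := by simp
  add_mem' := by
    rintro A B ⟨h1, h2, h3⟩ ⟨k1, k2, k3⟩
    refine ⟨fun x y z w => ?_, fun x y z w => ?_, fun x y z w => ?_⟩
    · simp only [add_apply]
      linarith [h1 x y z w, k1 x y z w]
    · simp only [add_apply]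
      linarith [h2 x y z w, k2 x y z w]
    · simp only [add_apply]
      linarith [h3 x y z w, k3 x y z w]
  smul_mem' := by
    rintro c A ⟨h1, h2, h3⟩
    refine ⟨fun x y z w => ?_, fun x y z w => ?_, fun x y z w => ?_⟩
    · simp only [smul_apply, smul_eq_mul]
      rw [h1 x y z w]; ring
    · simp only [smul_apply, smul_eq_mul]
      rw [h2 x y z w]
    · simp only [smul_apply, smul_eq_mul]
      rw [← mul_add, ← mul_add, h3 x y z w, mul_zero]

/-- The space `S²₊(V*) ⊗ S²(V*) ⊂ ⊗⁴ V*`: the 4-tensors that are symmetric and `J`-invariant in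
the first two arguments and symmetric in the last two. -/
def symPlusTensorSym (J : HermitianComplexStructure V) : Submodule ℝ (Tensor4 V) where
  carrier := {Θ | (∀ x y z w, Θ ![y, x, z, w] = Θ ![x, y, z, w]) ∧
    (∀ x y z w, Θ ![J.J x, J.J y, z, w] = Θ ![x, y, z, w]) ∧
    (∀ x y z w, Θ ![x, y, w, z] = Θ ![x, y, z, w])}
  zero_mem' := by simp
  add_mem' := by
    rintro A B ⟨h1, h2, h3⟩ ⟨k1, k2, k3⟩
    refine ⟨fun x y z w => ?_, fun x y z w => ?_, fun x y z w => ?_⟩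
    · simp only [add_apply, h1 x y z w, k1 x y z w]
    · simp only [add_apply, h2 x y z w, k2 x y z w]
    · simp only [add_apply, h3 x y z w, k3 x y z w]
  smul_mem' := by
    rintro c A ⟨h1, h2, h3⟩
    refine ⟨fun x y z w => ?_, fun x y z w => ?_, fun x y z w => ?_⟩
    · simp only [smul_apply, h1 x y z w]
    · simp only [smul_apply, h2 x y z w]
    · simp only [smul_apply, h3 x y z w]

/-- The permutation of the arguments of a 4-tensor that turns `(x, y, z, w)` into
`(x, z, y, w)`. -/
def permXZYW : Equiv.Perm (Fin 4) := ⟨![0, 2, 1, 3], ![0, 2, 1, 3], by decide, by decide⟩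

/-- The permutation that turns `(x, y, z, w)` into `(y, w, x, z)`. -/
def permYWXZ : Equiv.Perm (Fin 4) := ⟨![1, 3, 0, 2], ![2, 0, 3, 1], by decide, by decide⟩

/-- The permutation that turns `(x, y, z, w)` into `(x, w, y, z)`. -/
def permXWYZ : Equiv.Perm (Fin 4) := ⟨![0, 3, 1, 2], ![0, 2, 3, 1], by decide, by decide⟩

/-- The permutation that turns `(x, y, z, w)` into `(y, z, x, w)`. -/
def permYZXW : Equiv.Perm (Fin 4) := ⟨![1, 2, 0, 3], ![2, 0, 1, 3], by decide, by decide⟩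

/-- The 4-tensor `Θ(x,z,y,w) + Θ(y,w,x,z) - Θ(x,w,y,z) - Θ(y,z,x,w)`, see `curvOf_apply`. -/
def curvOf (Θ : Tensor4 V) : Tensor4 V :=
  Θ.domDomCongr permXZYW + Θ.domDomCongr permYWXZ
    - Θ.domDomCongr permXWYZ - Θ.domDomCongr permYZXW

theorem curvOf_apply (Θ : Tensor4 V) (x y z w : V) :
    curvOf Θ ![x, y, z, w]
      = Θ ![x, z, y, w] + Θ ![y, w, x, z] - Θ ![x, w, y, z] - Θ ![y, z, x, w] := by
  have e1 : (fun i => ![x, y, z, w] (permXZYW i)) = ![x, z, y, w] := by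
    funext i; fin_cases i <;> rfl
  have e2 : (fun i => ![x, y, z, w] (permYWXZ i)) = ![y, w, x, z] := by
    funext i; fin_cases i <;> rfl
  have e3 : (fun i => ![x, y, z, w] (permXWYZ i)) = ![x, w, y, z] := by
    funext i; fin_cases i <;> rfl
  have e4 : (fun i => ![x, y, z, w] (permYZXW i)) = ![y, z, x, w] := by
    funext i; fin_cases i <;> rfl
  simp only [curvOf, sub_apply, add_apply,
    MultilinearMap.domDomCongr_apply, e1, e2, e3, e4]

/-- The linear map `ℒ : S²₊(V*) ⊗ S²(V*) → 𝔄`,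
`ℒ(Θ)(x,y,z,w) = Θ(x,z,y,w) + Θ(y,w,x,z) - Θ(x,w,y,z) - Θ(y,z,x,w)`. -/
def curvMap (J : HermitianComplexStructure V) : symPlusTensorSym J →ₗ[ℝ] algCurv V where
  toFun Θ := ⟨curvOf Θ.1, by
    obtain ⟨Θ, h1, h2, h3⟩ := Θ
    refine ⟨fun x y z w => ?_, fun x y z w => ?_, fun x y z w => ?_⟩
    · simp only [curvOf_apply]; ring
    · simp only [curvOf_apply]
      linarith [h1 x z y w, h3 x z y w, h1 y w x z, h3 y w x z, h1 x w y z, h3 x w y z,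
        h1 y z x w, h3 y z x w, h3 z x y w, h3 w y x z, h3 z y x w, h3 w x y z]
    · simp only [curvOf_apply]
      linarith [h1 x z y w, h3 x z y w, h1 y w x z, h3 y w x z, h1 x w y z, h3 x w y z,
        h1 y z x w, h3 y z x w, h1 x y z w, h3 x y z w, h1 z w x y, h3 z w x y,
        h3 z x y w, h3 y x z w, h3 z y x w]⟩
  map_add' Θ Φ := by
    ext v
    simp [curvOf]
    ring
  map_smul' c Θ := by
    ext v
    simp [curvOf]
    ring

/-- `𝔏 = Range(ℒ) ⊂ 𝔄`. -/
def curvRange (J : HermitianComplexStructure V) : Submodule ℝ (algCurv V) :=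
  LinearMap.range (curvMap J)

end Algebra

/-! ### The curvature of a metric on an open subset of a vector space -/

section LocalCurvature

variable {F : Type*} [NormedAddCommGroup F] [NormedSpace ℝ F]

/-- Christoffel symbols of the first kind of a field `G` of bilinear forms on `F`: the functional
`Z ↦ ½ (∂_X G(Y, Z) + ∂_Y G(X, Z) - ∂_Z G(X, Y))` at the point `u`. -/
def christoffelFirst (G : F → F →L[ℝ] F →L[ℝ] ℝ) (u X Y : F) : F →L[ℝ] ℝ :=
  (1 / 2 : ℝ) • (fderiv ℝ G u X Y + fderiv ℝ G u Y X - ((fderiv ℝ G u).flip X).flip Y)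

/-- Christoffel symbols of the second kind (the Levi-Civita connection `∇_X Y` on constant vector
fields `X`, `Y`): the index of `christoffelFirst` is raised with the metric `G u`. -/
def christoffel (G : F → F →L[ℝ] F →L[ℝ] ℝ) (u X Y : F) : F :=
  (G u).inverse (christoffelFirst G u X Y)

/-- The curvature operator `R(X, Y) Z = ∇_X ∇_Y Z - ∇_Y ∇_X Z` (`X`, `Y`, `Z` constant fields). -/
def curvatureOperator (G : F → F →L[ℝ] F →L[ℝ] ℝ) (u X Y Z : F) : F :=
  fderiv ℝ (fun v => christoffel G v Y Z) u X - fderiv ℝ (fun v => christoffel G v X Z) u Y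
    + christoffel G u X (christoffel G u Y Z) - christoffel G u Y (christoffel G u X Z)

/-- The Riemann curvature tensor `R(X, Y, Z, W) = G(R(X, Y) Z, W)`. -/
def curvatureTensor (G : F → F →L[ℝ] F →L[ℝ] ℝ) (u X Y Z W : F) : ℝ :=
  G u (curvatureOperator G u X Y Z) W

end LocalCurvature

/-! ### Hermitian manifolds -/

/-- The model of `2n`-dimensional real manifolds. -/
abbrev Model (n : ℕ) : Type := EuclideanSpace ℝ (Fin (2 * n))

section Manifold

variable (n : ℕ) (M : Type*) [TopologicalSpace M] [ChartedSpace (Model n) M]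
  [IsManifold (𝓡 (2 * n)) ∞ M]

/-- An almost Hermitian structure on a smooth manifold `M` of real dimension `2n`: a smooth
Riemannian metric `g` and a smooth almost complex structure `J` with `J^* g = g`. -/
structure AlmostHermitianStructure where
  g : Bundle.ContMDiffRiemannianMetric (𝓡 (2 * n)) ∞ (Model n)
    (fun p : M => TangentSpace (𝓡 (2 * n)) p)
  J : ∀ p : M, TangentSpace (𝓡 (2 * n)) p →L[ℝ] TangentSpace (𝓡 (2 * n)) p
  contMDiff_J : ContMDiff (𝓡 (2 * n)) ((𝓡 (2 * n)).prod 𝓘(ℝ, Model n →L[ℝ] Model n)) ∞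
    (fun p => Bundle.TotalSpace.mk' (Model n →L[ℝ] Model n)
      (E := fun p : M => TangentSpace (𝓡 (2 * n)) p →L[ℝ] TangentSpace (𝓡 (2 * n)) p) p (J p))
  J_sq : ∀ (p : M) (v : TangentSpace (𝓡 (2 * n)) p), J p (J p v) = -v
  J_isometry : ∀ (p : M) (v w : TangentSpace (𝓡 (2 * n)) p),
    g.inner p (J p v) (J p w) = g.inner p v w

variable {M}

/-- The differential of the inverse of a coordinate system `e` at the point `u` of its target. -/
def dSymm {F : Type*} [NormedAddCommGroup F] [NormedSpace ℝ F] (e : OpenPartialHomeomorph M F)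
    (u : F) : F →L[ℝ] TangentSpace (𝓡 (2 * n)) (e.symm u) :=
  mfderiv 𝓘(ℝ, F) (𝓡 (2 * n)) e.symm u

/-- The differential of a coordinate system `e` at the point `p` of its source. -/
def dChart {F : Type*} [NormedAddCommGroup F] [NormedSpace ℝ F] (e : OpenPartialHomeomorph M F)
    (p : M) : TangentSpace (𝓡 (2 * n)) p →L[ℝ] F :=
  mfderiv (𝓡 (2 * n)) 𝓘(ℝ, F) e p

variable {n}

namespace AlmostHermitianStructure

variable (S : AlmostHermitianStructure n M)

/-- The Kähler form `Ω(x, y) = g(x, J y)` as a field of alternating forms. -/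
def kahlerForm (p : M) : TangentSpace (𝓡 (2 * n)) p [⋀^Fin 2]→L[ℝ] ℝ where
  toFun v := S.g.inner p (v 0) (S.J p (v 1))
  map_update_add' v i x y := by
    fin_cases i <;> simp
  map_update_smul' v i c x := by
    fin_cases i <;> simp
  cont := by
    have h : ∀ (b : Model n →L[ℝ] Model n →L[ℝ] ℝ) (K : Model n →L[ℝ] Model n),
        Continuous fun v : Fin 2 → Model n => b (v 0) (K (v 1)) := fun b K => by fun_prop
    exact h (S.g.inner p) (S.J p)
  map_eq_zero_of_eq' v i j hv hij := by
    have key : v 0 = v 1 → S.g.inner p (v 0) (S.J p (v 1)) = 0 := fun h => by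
      have h1 := S.J_isometry p (v 1) (S.J p (v 1))
      rw [S.J_sq, map_neg, S.g.symm] at h1
      rw [h]
      linarith
    fin_cases i <;> fin_cases j <;> simp_all

/-- The metric in the coordinate system `e`: at a point `u` of the target of `e`, the value on
`(X, Y)` is `g(∂_X, ∂_Y)`, with `∂_X` the coordinate vector field in the direction `X`. -/
def metricIn {F : Type*} [NormedAddCommGroup F] [NormedSpace ℝ F]
    (e : OpenPartialHomeomorph M F) (u : F) : F →L[ℝ] F →L[ℝ] ℝ :=
  (ContinuousLinearMap.precomp ℝ (dSymm n e u)).comp ((S.g.inner (e.symm u)).comp (dSymm n e u))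

theorem metricIn_apply {F : Type*} [NormedAddCommGroup F] [NormedSpace ℝ F]
    (e : OpenPartialHomeomorph M F) (u X Y : F) :
    S.metricIn e u X Y = S.g.inner (e.symm u) (dSymm n e u X) (dSymm n e u Y) := rfl

/-- The Kähler form in the coordinate system `e`. -/
def kahlerFormIn {F : Type*} [NormedAddCommGroup F] [NormedSpace ℝ F]
    (e : OpenPartialHomeomorph M F) (u : F) : F [⋀^Fin 2]→L[ℝ] ℝ :=
  (S.kahlerForm (e.symm u)).compContinuousLinearMap (dSymm n e u)

/-- The exterior derivative `dΩ(P)` of the Kähler form, a 3-form on `T_P M`, computed in the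
chart of `M` at `P`. -/
def dKahler (P : M) : TangentSpace (𝓡 (2 * n)) P [⋀^Fin 3]→L[ℝ] ℝ :=
  (extDeriv (S.kahlerFormIn (chartAt (Model n) P)) (chartAt (Model n) P P)).compContinuousLinearMap
    (dChart n (chartAt (Model n) P) P)

/-- The Riemann curvature tensor `R_P` of `g` on `T_P M`, computed in the chart of `M` at `P`. -/
def riemann (P : M) (x y z w : TangentSpace (𝓡 (2 * n)) P) : ℝ :=
  curvatureTensor (S.metricIn (chartAt (Model n) P)) (chartAt (Model n) P P)
    (dChart n (chartAt (Model n) P) P x) (dChart n (chartAt (Model n) P) P y)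
    (dChart n (chartAt (Model n) P) P z) (dChart n (chartAt (Model n) P) P w)

/-- Holomorphic coordinates `z = (z₁, …, z_n)`, `z_a = x_a + i y_a`, on an open subset of `M`:
smooth coordinates such that `J ∂_{x_a} = ∂_{y_a}` and `J ∂_{y_a} = -∂_{x_a}`, that is, such that
`dz` intertwines `J` with multiplication by `i`. -/
structure IsHolomorphicChart (z : OpenPartialHomeomorph M (EuclideanSpace ℂ (Fin n))) : Prop where
  smooth : ContMDiffOn (𝓡 (2 * n)) 𝓘(ℝ, EuclideanSpace ℂ (Fin n)) ∞ z z.source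
  smooth_symm : ContMDiffOn 𝓘(ℝ, EuclideanSpace ℂ (Fin n)) (𝓡 (2 * n)) ∞ z.symm z.target
  map_J : ∀ p ∈ z.source, ∀ v : TangentSpace (𝓡 (2 * n)) p,
    dChart n z p (S.J p v) = Complex.I • dChart n z p v

end AlmostHermitianStructure

variable (n M) in
/-- A Hermitian structure: an almost Hermitian structure with `J` integrable, i.e. there are
holomorphic coordinates in a neighbourhood of any point. -/
structure HermitianStructure extends AlmostHermitianStructure n M where
  integrable : ∀ P : M, ∃ z : OpenPartialHomeomorph M (EuclideanSpace ℂ (Fin n)),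
    toAlmostHermitianStructure.IsHolomorphicChart z ∧ P ∈ z.source

/-- The complex curvature model `(V, ⟨·,·⟩, J, A)` is geometrically realized at the point `P`. -/
def AlmostHermitianStructure.Realizes (S : AlmostHermitianStructure n M) (P : M)
    {V : Type*} [NormedAddCommGroup V] [InnerProductSpace ℝ V]
    (J : HermitianComplexStructure V) (A : algCurv V) : Prop :=
  ∃ φ : V ≃ₗ[ℝ] TangentSpace (𝓡 (2 * n)) P,
    (∀ x y, inner ℝ x y = S.g.inner P (φ x) (φ y)) ∧
    (∀ x, φ (J.J x) = S.J P (φ x)) ∧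
    (∀ x y z w, A.1 ![x, y, z, w] = S.riemann P (φ x) (φ y) (φ z) (φ w))

end Manifold

end HermitianCurvature

end

/-! In holomorphic coordinates `J` is constant, so dΩ(P) is a combination of first derivatives of
the metric. If the metric is standard up to O(|z|²) these vanish, hence dΩ(P) = 0. Conversely, dΩ(P)
= 0 says that the Christoffel symbols Γ at P commute with `i` (`christoffelCLM_complexLinear`). As Γ
is also symmetric, it is complex bilinear, and for a complex linear unitary frame `L` the quadratic
map ψ(u) = c + Lu - ½Γ(Lu, Lu) is holomorphic. The first derivative at 0 of the metric pulled back
by ψ is the covariant derivative of the metric, which is zero (`fderiv_pullbackForm_normalMap`), so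
ψ⁻¹ turns the given coordinates into osculating ones.

For the curvature, at a critical point of the metric the terms quadratic in Γ vanish and R is an
alternating sum of the Hessian (`curvatureTensor_of_fderiv_eq_zero`). This sum is ℒ(Θ) with Θ half
the Hessian, the metric arguments placed first. Θ is symmetric and J-invariant in the metric
arguments and symmetric in the directions of differentiation, so R lies in 𝔏. Since R is defined in
a preferred chart, this uses naturality of curvature (`curvatureTensor_pullbackForm`). Conversely,
for Θ given, the metric ⟨X, Y⟩ + Θ(X, Y, u, u) on a small ball with constant J is Hermitian, is
critical at 0 and has Hessian 2Θ there, so its curvature at 0 is ℒ(Θ). -/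

noncomputable section

namespace HermitianCurvature

/-! ### Christoffel symbols and curvature in coordinates, and their naturality -/

section LocalCalculus

open Filter

set_option maxSynthPendingDepth 4

variable {E F : Type*} [NormedAddCommGroup E] [NormedSpace ℝ E] [NormedAddCommGroup F]
  [NormedSpace ℝ F]

/-- The linear map that turns the derivative of a field of bilinear forms into the Christoffel
symbols of the first kind. -/
def christoffelFirstCLM (D : F →L[ℝ] F →L[ℝ] F →L[ℝ] ℝ) : F →L[ℝ] F →L[ℝ] F →L[ℝ] ℝ :=
  (1 / 2 : ℝ) • (D + D.flip -
    (ContinuousLinearMap.flipₗᵢ ℝ F F ℝ).toContinuousLinearEquiv.toContinuousLinearMap ∘L D.flip)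

theorem christoffelFirst_eq (G : F → F →L[ℝ] F →L[ℝ] ℝ) (u X Y : F) :
    christoffelFirst G u X Y = christoffelFirstCLM (fderiv ℝ G u) X Y := by
  ext Z
  simp [christoffelFirst, christoffelFirstCLM]

theorem christoffelFirstCLM_apply (D : F →L[ℝ] F →L[ℝ] F →L[ℝ] ℝ) (X Y Z : F) :
    christoffelFirstCLM D X Y Z = 1 / 2 * (D X Y Z + D Y X Z - D Z X Y) := by
  simp [christoffelFirstCLM]

theorem contDiff_christoffelFirstCLM {k : WithTop ℕ∞} :
    ContDiff ℝ k (christoffelFirstCLM (F := F)) := by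
  have h : ContDiff ℝ k fun D : F →L[ℝ] F →L[ℝ] F →L[ℝ] ℝ => D.flip :=
    (ContinuousLinearMap.flipₗᵢ ℝ F F (F →L[ℝ] ℝ)).contDiff
  unfold christoffelFirstCLM
  exact ((contDiff_id.add h).sub (contDiff_const.clm_comp h)).const_smul (1 / 2 : ℝ)

/-- The Christoffel symbols of the second kind as a bilinear map. -/
def christoffelCLM (G : F → F →L[ℝ] F →L[ℝ] ℝ) (u : F) : F →L[ℝ] F →L[ℝ] F :=
  ContinuousLinearMap.compL ℝ F (F →L[ℝ] ℝ) F (G u).inverse ∘L christoffelFirstCLM (fderiv ℝ G u)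

theorem christoffel_eq (G : F → F →L[ℝ] F →L[ℝ] ℝ) (u X Y : F) :
    christoffel G u X Y = christoffelCLM G u X Y := by
  simp [christoffel, christoffelCLM, christoffelFirst_eq]

theorem contDiffAt_christoffelCLM [CompleteSpace F] {G : F → F →L[ℝ] F →L[ℝ] ℝ} {u : F}
    {k : WithTop ℕ∞} (hG : ContDiffAt ℝ (k + 1) G u) (hinv : (G u).IsInvertible) :
    ContDiffAt ℝ k (christoffelCLM G) u := by
  have h1 : ContDiffAt ℝ k (fun v => (G v).inverse) u :=
    hinv.contDiffAt_map_inverse.comp u (hG.of_le le_self_add)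
  have h2 : ContDiffAt ℝ k (fun v => christoffelFirstCLM (fderiv ℝ G v)) u :=
    contDiff_christoffelFirstCLM.contDiffAt.comp u (hG.fderiv_right le_rfl)
  unfold christoffelCLM
  exact ((ContinuousLinearMap.contDiff _).contDiffAt.comp u h1).clm_comp h2

theorem apply_christoffelCLM {G : F → F →L[ℝ] F →L[ℝ] ℝ} {u : F} (hinv : (G u).IsInvertible)
    (X Y Z : F) :
    G u (christoffelCLM G u X Y) Z =
      1 / 2 * (fderiv ℝ G u X Y Z + fderiv ℝ G u Y X Z - fderiv ℝ G u Z X Y) := by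
  simp [christoffelCLM, hinv.self_apply_inverse, christoffelFirstCLM_apply]

/-- Differentiating Γ as a map into bilinear maps, instead of with frozen arguments, makes the
product rule available when the arguments vary too. -/
theorem curvatureTensor_eq [CompleteSpace F] {G : F → F →L[ℝ] F →L[ℝ] ℝ} {u : F}
    (hG : ContDiffAt ℝ 2 G u) (hinv : (G u).IsInvertible) (X Y Z W : F) :
    curvatureTensor G u X Y Z W =
      G u (fderiv ℝ (christoffelCLM G) u X Y Z - fderiv ℝ (christoffelCLM G) u Y X Z
        + christoffelCLM G u X (christoffelCLM G u Y Z)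
        - christoffelCLM G u Y (christoffelCLM G u X Z)) W := by
  have hd : DifferentiableAt ℝ (christoffelCLM G) u :=
    (contDiffAt_christoffelCLM (k := 1) (by norm_num; exact hG) hinv).differentiableAt (by simp)
  have h : ∀ A B C : F, fderiv ℝ (fun v => christoffelCLM G v A B) u C =
      fderiv ℝ (christoffelCLM G) u C A B := by
    intro A B C
    have := (hd.hasFDerivAt.clm_apply (hasFDerivAt_const A u)).clm_apply (hasFDerivAt_const B u)
    rw [this.fderiv]
    simp
  simp only [curvatureTensor, curvatureOperator, christoffel_eq, h]

theorem fderiv_apply_apply {G : E → F →L[ℝ] F →L[ℝ] ℝ} {u : E} (hG : DifferentiableAt ℝ G u)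
    (X Y : F) (W : E) : fderiv ℝ (fun v => G v X Y) u W = fderiv ℝ G u W X Y := by
  have := (hG.hasFDerivAt.clm_apply (hasFDerivAt_const X u)).clm_apply (hasFDerivAt_const Y u)
  rw [this.fderiv]
  simp

theorem fderiv_symm {G : E → F →L[ℝ] F →L[ℝ] ℝ} {u : E} (hG : DifferentiableAt ℝ G u)
    (hsym : ∀ᶠ v in 𝓝 u, ∀ X Y, G v X Y = G v Y X) (W : E) (X Y : F) :
    fderiv ℝ G u W X Y = fderiv ℝ G u W Y X := by
  rw [← fderiv_apply_apply hG, ← fderiv_apply_apply hG]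
  exact congrArg (fun L : E →L[ℝ] ℝ => L W)
    (Filter.EventuallyEq.fderiv_eq (hsym.mono fun v hv => hv X Y))

theorem eventually_isInvertible [CompleteSpace F] {H : E → E →L[ℝ] F} [CompleteSpace E] {u : E}
    (hH : ContinuousAt H u) (h : (H u).IsInvertible) : ∀ᶠ v in 𝓝 u, (H v).IsInvertible := by
  obtain ⟨e, he⟩ := h
  exact hH (he ▸ e.nhds)

/-- The pullback of a field of bilinear forms under a map. -/
def pullbackForm (ψ : E → F) (G : F → F →L[ℝ] F →L[ℝ] ℝ) (u : E) : E →L[ℝ] E →L[ℝ] ℝ :=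
  (G (ψ u)).bilinearComp (fderiv ℝ ψ u) (fderiv ℝ ψ u)

theorem pullbackForm_apply (ψ : E → F) (G : F → F →L[ℝ] F →L[ℝ] ℝ) (u X Y : E) :
    pullbackForm ψ G u X Y = G (ψ u) (fderiv ℝ ψ u X) (fderiv ℝ ψ u Y) := rfl

theorem contDiffAt_pullbackForm {ψ : E → F} {G : F → F →L[ℝ] F →L[ℝ] ℝ} {u : E}
    {k : WithTop ℕ∞} (hψ : ContDiffAt ℝ (k + 1) ψ u) (hG : ContDiffAt ℝ k G (ψ u)) :
    ContDiffAt ℝ k (pullbackForm ψ G) u := by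
  have h1 : ContDiffAt ℝ k (fderiv ℝ ψ) u := hψ.fderiv_right le_rfl
  have h2 : ContDiffAt ℝ k (fun v => G (ψ v)) u := hG.comp u (hψ.of_le le_self_add)
  have h3 : ContDiffAt ℝ k (fun v => ((G (ψ v)) ∘L fderiv ℝ ψ v).flip) u :=
    (ContinuousLinearMap.flipₗᵢ ℝ E F ℝ).contDiff.contDiffAt.comp u (h2.clm_comp h1)
  have h4 := (ContinuousLinearMap.flipₗᵢ ℝ E E ℝ).contDiff.contDiffAt.comp u (h3.clm_comp h1)
  exact h4

theorem fderiv_pullbackForm {ψ : E → F} {G : F → F →L[ℝ] F →L[ℝ] ℝ} {u : E}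
    (hψ : ContDiffAt ℝ 2 ψ u) (hG : ContDiffAt ℝ 1 G (ψ u)) (W X Y : E) :
    fderiv ℝ (pullbackForm ψ G) u W X Y =
      fderiv ℝ G (ψ u) (fderiv ℝ ψ u W) (fderiv ℝ ψ u X) (fderiv ℝ ψ u Y)
      + G (ψ u) (fderiv ℝ (fderiv ℝ ψ) u W X) (fderiv ℝ ψ u Y)
      + G (ψ u) (fderiv ℝ ψ u X) (fderiv ℝ (fderiv ℝ ψ) u W Y) := by
  have hd : DifferentiableAt ℝ (pullbackForm ψ G) u :=
    (contDiffAt_pullbackForm (k := 1) (by norm_num; exact hψ) hG).differentiableAt (by simp)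
  rw [← fderiv_apply_apply hd]
  have h1 : HasFDerivAt (fderiv ℝ ψ) (fderiv ℝ (fderiv ℝ ψ) u) u :=
    ((hψ.fderiv_right (m := 1) (by norm_num)).differentiableAt (by simp)).hasFDerivAt
  have h2 : HasFDerivAt (fun v => G (ψ v)) (fderiv ℝ G (ψ u) ∘L fderiv ℝ ψ u) u :=
    (hG.differentiableAt (by simp)).hasFDerivAt.comp u (hψ.differentiableAt (by simp)).hasFDerivAt
  have h3 := (h2.clm_apply (h1.clm_apply (hasFDerivAt_const X u))).clm_apply
    (h1.clm_apply (hasFDerivAt_const Y u))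
  simp only [pullbackForm_apply]
  rw [h3.fderiv]
  simp
  ring

/-- The inhomogeneous transformation law of a connection. It is checked by pairing both sides with
dψ(Z) and comparing Koszul formulas. -/
theorem christoffelCLM_pullbackForm {ψ : E → F} {G : F → F →L[ℝ] F →L[ℝ] ℝ} {u : E}
    (hψ : ContDiffAt ℝ 2 ψ u) (hG : ContDiffAt ℝ 1 G (ψ u)) (hinv : (fderiv ℝ ψ u).IsInvertible)
    (hGinv : (G (ψ u)).IsInvertible) (hsym : ∀ᶠ w in 𝓝 (ψ u), ∀ X Y, G w X Y = G w Y X)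
    (hpinv : (pullbackForm ψ G u).IsInvertible) (X Y : E) :
    fderiv ℝ ψ u (christoffelCLM (pullbackForm ψ G) u X Y) =
      christoffelCLM G (ψ u) (fderiv ℝ ψ u X) (fderiv ℝ ψ u Y) + fderiv ℝ (fderiv ℝ ψ) u X Y := by
  apply hGinv.injective
  ext Z'
  obtain ⟨Z, rfl⟩ := hinv.surjective Z'
  rw [← pullbackForm_apply, apply_christoffelCLM hpinv, map_add, add_apply,
    apply_christoffelCLM hGinv]
  simp only [fderiv_pullbackForm hψ hG]
  -- Of the six terms with second derivatives of ψ, symmetry of `G` and of D²ψ cancels four; the two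
  -- others add up to 2 G(D²ψ(X, Y), dψ Z).
  have hs : ∀ A B, fderiv ℝ (fderiv ℝ ψ) u A B = fderiv ℝ (fderiv ℝ ψ) u B A :=
    fun A B => (hψ.isSymmSndFDerivAt (by simp)).eq A B
  have hg := hsym.self_of_nhds
  rw [hs Z X, hs Z Y, hs Y X, hg (fderiv ℝ ψ u X) (fderiv ℝ (fderiv ℝ ψ) u Y Z),
    hg (fderiv ℝ ψ u Y) (fderiv ℝ (fderiv ℝ ψ) u X Z)]
  ring

theorem isInvertible_pullbackForm {ψ : E → F} {G : F → F →L[ℝ] F →L[ℝ] ℝ} {u : E}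
    (hinv : (fderiv ℝ ψ u).IsInvertible) (hGinv : (G (ψ u)).IsInvertible) :
    (pullbackForm ψ G u).IsInvertible := by
  obtain ⟨e, he⟩ := hinv
  obtain ⟨g, hg⟩ := hGinv
  refine ⟨(e.trans g).trans (e.symm.arrowCongr (ContinuousLinearEquiv.refl ℝ ℝ)), ?_⟩
  ext X Y
  simp [pullbackForm_apply, ← he, ← hg]

/-- The Riemann curvature tensor is natural under local diffeomorphisms. -/
theorem curvatureTensor_pullbackForm [CompleteSpace E] [CompleteSpace F] {ψ : E → F}
    {G : F → F →L[ℝ] F →L[ℝ] ℝ} {u : E}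
    (hψ : ContDiffAt ℝ 3 ψ u) (hG : ContDiffAt ℝ 2 G (ψ u)) (hinv : (fderiv ℝ ψ u).IsInvertible)
    (hGinv : (G (ψ u)).IsInvertible) (hsym : ∀ᶠ w in 𝓝 (ψ u), ∀ X Y, G w X Y = G w Y X)
    (X Y Z W : E) :
    curvatureTensor (pullbackForm ψ G) u X Y Z W =
      curvatureTensor G (ψ u) (fderiv ℝ ψ u X) (fderiv ℝ ψ u Y) (fderiv ℝ ψ u Z)
        (fderiv ℝ ψ u W) := by
  have hψ2 : ContDiffAt ℝ 2 ψ u := hψ.of_le (by norm_num)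
  have hψc : ContinuousAt ψ u := hψ.continuousAt
  have hpinv := isInvertible_pullbackForm (G := G) hinv hGinv
  have hp : ContDiffAt ℝ 2 (pullbackForm ψ G) u :=
    contDiffAt_pullbackForm (by norm_num; exact hψ) hG
  rw [curvatureTensor_eq hp hpinv, curvatureTensor_eq hG hGinv, pullbackForm_apply]
  have e1 : ∀ᶠ v in 𝓝 u, ∀ X Y : E,
      fderiv ℝ ψ v (christoffelCLM (pullbackForm ψ G) v X Y) =
      christoffelCLM G (ψ v) (fderiv ℝ ψ v X) (fderiv ℝ ψ v Y)
        + fderiv ℝ (fderiv ℝ ψ) v X Y := by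
    filter_upwards [hψ2.eventually (by simp),
      hψc.eventually ((hG.of_le (by norm_num : (1 : WithTop ℕ∞) ≤ 2)).eventually (by simp)),
      eventually_isInvertible (hψ2.fderiv_right (m := 1) (by norm_num)).continuousAt hinv,
      hψc.eventually (eventually_isInvertible hG.continuousAt hGinv),
      hψc.eventually hsym.eventually_nhds] with v h1 h2 h3 h4 h5 X Y
    exact christoffelCLM_pullbackForm h1 h2 h3 h4 h5 (isInvertible_pullbackForm h3 h4) X Y
  have hd1 : HasFDerivAt (fderiv ℝ ψ) (fderiv ℝ (fderiv ℝ ψ) u) u :=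
    ((hψ.fderiv_right (m := 2) (by norm_num)).differentiableAt (by simp)).hasFDerivAt
  have hd2 : HasFDerivAt (fderiv ℝ (fderiv ℝ ψ)) (fderiv ℝ (fderiv ℝ (fderiv ℝ ψ)) u) u :=
    (((hψ.fderiv_right (m := 2) (by norm_num)).fderiv_right
      (m := 1) (by norm_num)).differentiableAt (by simp)).hasFDerivAt
  have hdp : HasFDerivAt (christoffelCLM (pullbackForm ψ G))
      (fderiv ℝ (christoffelCLM (pullbackForm ψ G)) u) u :=
    ((contDiffAt_christoffelCLM (k := 1) (by norm_num; exact hp) hpinv).differentiableAt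
      (by simp)).hasFDerivAt
  have hdg : HasFDerivAt (fun v => christoffelCLM G (ψ v))
      (fderiv ℝ (christoffelCLM G) (ψ u) ∘L fderiv ℝ ψ u) u :=
    ((contDiffAt_christoffelCLM (k := 1) (by norm_num; exact hG) hGinv).differentiableAt
      (by simp)).hasFDerivAt.comp u (hψ2.differentiableAt (by simp)).hasFDerivAt
  -- The derivative of the transformation law `e1` in the direction `A`; this is why it was needed
  -- in a whole neighbourhood.
  have key : ∀ A B C : E,
      fderiv ℝ ψ u (fderiv ℝ (christoffelCLM (pullbackForm ψ G)) u A B C)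
        + fderiv ℝ (fderiv ℝ ψ) u A (christoffelCLM (pullbackForm ψ G) u B C) =
      fderiv ℝ (christoffelCLM G) (ψ u) (fderiv ℝ ψ u A) (fderiv ℝ ψ u B) (fderiv ℝ ψ u C)
        + christoffelCLM G (ψ u) (fderiv ℝ (fderiv ℝ ψ) u A B) (fderiv ℝ ψ u C)
        + christoffelCLM G (ψ u) (fderiv ℝ ψ u B) (fderiv ℝ (fderiv ℝ ψ) u A C)
        + fderiv ℝ (fderiv ℝ (fderiv ℝ ψ)) u A B C := by
    intro A B C
    have hl := hd1.clm_apply ((hdp.clm_apply (hasFDerivAt_const B u)).clm_apply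
      (hasFDerivAt_const C u))
    have hr := ((hdg.clm_apply (hd1.clm_apply (hasFDerivAt_const B u))).clm_apply
      (hd1.clm_apply (hasFDerivAt_const C u))).add
      ((hd2.clm_apply (hasFDerivAt_const B u)).clm_apply (hasFDerivAt_const C u))
    have := congrArg (· A) ((hl.congr_of_eventuallyEq
      ((e1.mono fun v hv => (hv B C).symm))).unique hr)
    simp at this
    rw [this]
    abel
  have hs2 : ∀ A B, fderiv ℝ (fderiv ℝ ψ) u A B = fderiv ℝ (fderiv ℝ ψ) u B A :=
    fun A B => (hψ2.isSymmSndFDerivAt (by simp)).eq A B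
  have hs3 : ∀ A B C, fderiv ℝ (fderiv ℝ (fderiv ℝ ψ)) u A B C =
      fderiv ℝ (fderiv ℝ (fderiv ℝ ψ)) u B A C := fun A B C => congrArg (· C)
    (((hψ.fderiv_right (m := 2) (by norm_num)).isSymmSndFDerivAt (by simp)).eq A B)
  have e2 := e1.self_of_nhds
  congr 2
  simp only [map_add, map_sub, e2]
  -- Antisymmetrizing in X and Y removes the third derivatives of ψ and the terms in D²ψ(X, Y). The
  -- other second derivatives cancel against the inhomogeneous parts of the terms quadratic in Γ.
  rw [eq_sub_of_add_eq (key X Y Z), eq_sub_of_add_eq (key Y X Z), hs3 Y X Z, hs2 Y X]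
  abel

theorem curvatureTensor_congr {G H : F → F →L[ℝ] F →L[ℝ] ℝ} {u : F}
    (h : G =ᶠ[𝓝 u] H) (X Y Z W : F) : curvatureTensor G u X Y Z W = curvatureTensor H u X Y Z W := by
  have hc : ∀ A B, (fun v => christoffel G v A B) =ᶠ[𝓝 u] fun v => christoffel H v A B := by
    intro A B
    filter_upwards [h.eventuallyEq_nhds] with v hv
    simp only [christoffel, christoffelFirst, hv.fderiv_eq, hv.eq_of_nhds]
  simp only [curvatureTensor, curvatureOperator, (hc _ _).fderiv_eq, (hc _ _).eq_of_nhds,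
    h.eq_of_nhds]

/-- The curvature tensor at a critical point of the metric. -/
theorem curvatureTensor_of_fderiv_eq_zero [CompleteSpace F] {G : F → F →L[ℝ] F →L[ℝ] ℝ} {u : F}
    (hG : ContDiffAt ℝ 2 G u) (hinv : (G u).IsInvertible) (h0 : fderiv ℝ G u = 0)
    (X Y Z W : F) :
    curvatureTensor G u X Y Z W =
      1 / 2 * (fderiv ℝ (fderiv ℝ G) u Y W X Z + fderiv ℝ (fderiv ℝ G) u X Z Y W
        - fderiv ℝ (fderiv ℝ G) u Y Z X W - fderiv ℝ (fderiv ℝ G) u X W Y Z) := by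
  have hΓ : ∀ A B, christoffelCLM G u A B = 0 := by
    intro A B
    apply hinv.injective
    ext C
    rw [apply_christoffelCLM hinv, h0]
    simp
  have hd : HasFDerivAt (christoffelCLM G) (fderiv ℝ (christoffelCLM G) u) u :=
    ((contDiffAt_christoffelCLM (k := 1) (by norm_num; exact hG) hinv).differentiableAt
      (by simp)).hasFDerivAt
  have hd1 : HasFDerivAt G 0 u := h0 ▸ (hG.differentiableAt (by simp)).hasFDerivAt
  have hd2 : HasFDerivAt (fderiv ℝ G) (fderiv ℝ (fderiv ℝ G) u) u :=
    ((hG.fderiv_right (m := 1) (by norm_num)).differentiableAt (by simp)).hasFDerivAt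
  have key : ∀ A B C D : F, G u (fderiv ℝ (christoffelCLM G) u A B C) D =
      1 / 2 * (fderiv ℝ (fderiv ℝ G) u A B C D + fderiv ℝ (fderiv ℝ G) u A C B D
        - fderiv ℝ (fderiv ℝ G) u A D B C) := by
    intro A B C D
    have hl := (hd1.clm_apply ((hd.clm_apply (hasFDerivAt_const B u)).clm_apply
      (hasFDerivAt_const C u))).clm_apply (hasFDerivAt_const D u)
    have h1 := (((hd2.clm_apply (hasFDerivAt_const B u)).clm_apply
      (hasFDerivAt_const C u)).clm_apply (hasFDerivAt_const D u))
    have h2 := (((hd2.clm_apply (hasFDerivAt_const C u)).clm_apply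
      (hasFDerivAt_const B u)).clm_apply (hasFDerivAt_const D u))
    have h3 := (((hd2.clm_apply (hasFDerivAt_const D u)).clm_apply
      (hasFDerivAt_const B u)).clm_apply (hasFDerivAt_const C u))
    have hr := ((h1.add h2).sub h3).const_mul (1 / 2 : ℝ)
    have he : (fun v => G v (christoffelCLM G v B C) D) =ᶠ[𝓝 u] fun v => 1 / 2 *
        (fderiv ℝ G v B C D + fderiv ℝ G v C B D - fderiv ℝ G v D B C) := by
      filter_upwards [eventually_isInvertible hG.continuousAt hinv] with v hv
      exact apply_christoffelCLM hv B C D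
    have := congrArg (· A) ((hl.congr_of_eventuallyEq he.symm).unique hr)
    simpa using this
  have hs : ∀ A B, fderiv ℝ (fderiv ℝ G) u A B = fderiv ℝ (fderiv ℝ G) u B A :=
    fun A B => (hG.isSymmSndFDerivAt (by simp)).eq A B
  rw [curvatureTensor_eq hG hinv]
  simp only [hΓ, add_zero, sub_zero, map_sub, sub_apply, key]
  rw [hs Y X]
  ring

end LocalCalculus

/-! ### Consequences of dΩ = 0 and the quadratic change of coordinates -/

section KahlerCondition

open Filter Asymptotics

set_option maxSynthPendingDepth 4

variable {E F : Type*} [NormedAddCommGroup E] [NormedSpace ℝ E] [NormedAddCommGroup F]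
  [NormedSpace ℝ F]

theorem fderiv_invariant {G : F → F →L[ℝ] F →L[ℝ] ℝ} {u : F} (hG : DifferentiableAt ℝ G u)
    {J : F →L[ℝ] F} (hJ : ∀ᶠ v in 𝓝 u, ∀ X Y, G v (J X) (J Y) = G v X Y) (W X Y : F) :
    fderiv ℝ G u W (J X) (J Y) = fderiv ℝ G u W X Y := by
  rw [← fderiv_apply_apply hG, ← fderiv_apply_apply hG]
  exact congrArg (fun L : F →L[ℝ] ℝ => L W)
    (Filter.EventuallyEq.fderiv_eq (hJ.mono fun v hv => hv X Y))

/-- If the Kähler form of a Hermitian metric is closed at a point, then the Levi-Civita connection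
is complex linear there. -/
theorem christoffelCLM_complexLinear {G : F → F →L[ℝ] F →L[ℝ] ℝ} {u : F}
    (hG : DifferentiableAt ℝ G u) (hinv : (G u).IsInvertible)
    {J : F →L[ℝ] F} (hJJ : ∀ X, J (J X) = -X)
    (hJ : ∀ᶠ v in 𝓝 u, ∀ X Y, G v (J X) (J Y) = G v X Y)
    (hd : ∀ X Y Z, fderiv ℝ G u X Y (J Z) - fderiv ℝ G u Y X (J Z) + fderiv ℝ G u Z X (J Y) = 0)
    (X Y : F) : christoffelCLM G u X (J Y) = J (christoffelCLM G u X Y) := by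
  apply hinv.injective
  ext Z
  have skew : ∀ A B, G u (J A) B = -G u A (J B) := by
    intro A B
    rw [← hJ.self_of_nhds (J A) B, hJJ]
    simp
  have dskew : ∀ W A B, fderiv ℝ G u W (J A) B = -fderiv ℝ G u W A (J B) := by
    intro W A B
    rw [← fderiv_invariant hG hJ W (J A) B, hJJ]
    simp
  -- Both sides are now Koszul sums. Their difference is a combination of dΩ(X, Y, Z), dΩ(X, JY, JZ)
  -- and the skewness of `J` for the derivative of `G` along `X`.
  rw [skew, apply_christoffelCLM hinv, apply_christoffelCLM hinv]
  have h1 := hd X Y Z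
  have h2 := hd X (J Y) (J Z)
  simp only [hJJ, map_neg] at h2
  have h3 := dskew X Y Z
  linarith

/-- A quadratic map with prescribed value, first and second derivative at the origin. -/
def quadraticMap (c : F) (L : E →L[ℝ] F) (B : E →L[ℝ] E →L[ℝ] F) (u : E) : F :=
  c + L u + (1 / 2 : ℝ) • B u u

theorem contDiff_quadraticMap (c : F) (L : E →L[ℝ] F) (B : E →L[ℝ] E →L[ℝ] F)
    {k : WithTop ℕ∞} : ContDiff ℝ k (quadraticMap c L B) := by
  unfold quadraticMap
  fun_prop

theorem fderiv_quadraticMap (c : F) (L : E →L[ℝ] F) {B : E →L[ℝ] E →L[ℝ] F}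
    (hB : ∀ X Y, B X Y = B Y X) (u : E) : fderiv ℝ (quadraticMap c L B) u = L + B u := by
  have h1 : HasFDerivAt (fun v => B v) B u := B.hasFDerivAt
  have h := ((L.hasFDerivAt (x := u)).const_add c).add
    ((h1.clm_apply (hasFDerivAt_id u)).const_smul (1 / 2 : ℝ))
  refine h.fderiv.trans ?_
  ext X
  simp only [add_apply, smul_apply, ContinuousLinearMap.comp_apply,
    ContinuousLinearMap.flip_apply, ContinuousLinearMap.id_apply, id, hB X u]
  rw [← two_smul ℝ (B u X), smul_smul]
  norm_num

theorem fderiv_fderiv_quadraticMap (c : F) (L : E →L[ℝ] F) {B : E →L[ℝ] E →L[ℝ] F}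
    (hB : ∀ X Y, B X Y = B Y X) (u : E) : fderiv ℝ (fderiv ℝ (quadraticMap c L B)) u = B := by
  rw [funext (fderiv_quadraticMap c L hB)]
  exact ((B.hasFDerivAt (x := u)).const_add L).fderiv

theorem christoffelCLM_symm {G : F → F →L[ℝ] F →L[ℝ] ℝ} {u : F} (hG : DifferentiableAt ℝ G u)
    (hsym : ∀ᶠ v in 𝓝 u, ∀ X Y, G v X Y = G v Y X) (hinv : (G u).IsInvertible) (X Y : F) :
    christoffelCLM G u X Y = christoffelCLM G u Y X := by
  apply hinv.injective
  ext Z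
  rw [apply_christoffelCLM hinv, apply_christoffelCLM hinv, fderiv_symm hG hsym Z X Y]
  ring

/-- Coordinates in which the metric osculates its value at a point to second order. -/
def normalMap (G : F → F →L[ℝ] F →L[ℝ] ℝ) (c : F) (L : E →L[ℝ] F) : E → F :=
  quadraticMap c L (-(christoffelCLM G c).bilinearComp L L)

theorem normalMap_zero (G : F → F →L[ℝ] F →L[ℝ] ℝ) (c : F) (L : E →L[ℝ] F) :
    normalMap G c L 0 = c := by
  simp [normalMap, quadraticMap]

/-- This formula holds at every `u`, not only at 0. If `L` and each Γ(ξ, ·) commute with `i`, then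
so does every differential, and the map is holomorphic. -/
theorem fderiv_normalMap {G : F → F →L[ℝ] F →L[ℝ] ℝ} {c : F} (hG : DifferentiableAt ℝ G c)
    (hsym : ∀ᶠ v in 𝓝 c, ∀ X Y, G v X Y = G v Y X) (hinv : (G c).IsInvertible) (L : E →L[ℝ] F)
    (u X : E) : fderiv ℝ (normalMap G c L) u X = L X - christoffelCLM G c (L u) (L X) := by
  unfold normalMap
  rw [fderiv_quadraticMap]
  · simp [sub_eq_add_neg]
  · intro X Y
    simp [christoffelCLM_symm hG hsym hinv (L X)]

theorem fderiv_normalMap_zero {G : F → F →L[ℝ] F →L[ℝ] ℝ} {c : F} (hG : DifferentiableAt ℝ G c)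
    (hsym : ∀ᶠ v in 𝓝 c, ∀ X Y, G v X Y = G v Y X) (hinv : (G c).IsInvertible)
    (L : E →L[ℝ] F) : fderiv ℝ (normalMap G c L) 0 = L := by
  ext X
  simp [fderiv_normalMap hG hsym hinv]

/-- The derivative equals DG(LW; LX, LY) - G(Γ(LW, LX), LY) - G(LX, Γ(LW, LY)), which is zero
because the Levi-Civita connection is metric. -/
theorem fderiv_pullbackForm_normalMap {G : F → F →L[ℝ] F →L[ℝ] ℝ} {c : F}
    (hG : ContDiffAt ℝ 1 G c) (hsym : ∀ᶠ v in 𝓝 c, ∀ X Y, G v X Y = G v Y X)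
    (hinv : (G c).IsInvertible) (L : E →L[ℝ] F) :
    fderiv ℝ (pullbackForm (normalMap G c L) G) 0 = 0 := by
  have hGd : DifferentiableAt ℝ G c := hG.differentiableAt (by simp)
  have h2 : fderiv ℝ (fderiv ℝ (normalMap G c L)) 0 = -(christoffelCLM G c).bilinearComp L L := by
    refine fderiv_fderiv_quadraticMap _ _ (fun X Y => ?_) 0
    simp [christoffelCLM_symm hGd hsym hinv (L X)]
  ext W X Y
  have hψ : ContDiff ℝ 2 (normalMap G c L) := contDiff_quadraticMap _ _ _
  rw [fderiv_pullbackForm hψ.contDiffAt (by rwa [normalMap_zero]), normalMap_zero, fderiv_normalMap_zero hGd hsym hinv, h2]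
  have e1 := apply_christoffelCLM hinv (L W) (L X) (L Y)
  have e2 := apply_christoffelCLM hinv (L W) (L Y) (L X)
  have e3 := hsym.self_of_nhds (L X) (christoffelCLM G c (L W) (L Y))
  have e4 := fderiv_symm hGd hsym (L W) (L X) (L Y)
  simp
  linarith

/-- The derivative is differentiable and zero at 0, hence O(|u|); the mean value inequality on the
ball of radius |u| gives a second factor |u|. -/
theorem isBigO_norm_sq_of_fderiv_eq_zero {f : E → ℝ} (hf : ContDiffAt ℝ 2 f 0) (h0 : f 0 = 0)
    (h1 : fderiv ℝ f 0 = 0) : f =O[𝓝 0] fun u => ‖u‖ ^ 2 := by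
  have hd : DifferentiableAt ℝ (fderiv ℝ f) 0 :=
    (hf.fderiv_right (m := 1) (by norm_num)).differentiableAt (by simp)
  have hb : fderiv ℝ f =O[𝓝 0] fun u => u := by
    simpa [h1] using hd.isBigO_sub
  obtain ⟨C, hC⟩ := hb.bound
  obtain ⟨r, hr, hball⟩ := Metric.eventually_nhds_iff_ball.1
    (hC.and ((hf.eventually (by simp)).mono fun v hv => hv.differentiableAt (by simp)))
  refine IsBigO.of_bound C ?_
  filter_upwards [Metric.ball_mem_nhds 0 hr] with u hu
  have hu' : ‖u‖ < r := by simpa using hu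
  have hsub : Metric.closedBall (0 : E) ‖u‖ ⊆ Metric.ball 0 r :=
    Metric.closedBall_subset_ball hu'
  have hC0 : 0 ≤ C * ‖u‖ := (norm_nonneg _).trans (hball u hu).1
  have := (convex_closedBall (0 : E) ‖u‖).norm_image_sub_le_of_norm_fderiv_le (𝕜 := ℝ) (f := f)
    (C := C * ‖u‖) (x := 0) (y := u) (fun v hv => (hball v (hsub hv)).2) (fun v hv => by
      have hv' : ‖v‖ ≤ ‖u‖ := by simpa using hv
      refine (hball v (hsub hv)).1.trans ?_
      -- The constant supplied by `IsBigO.bound` may be negative, but then 0 ≤ C‖u‖ forces u = 0.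
      rcases le_or_gt 0 C with h | h
      · gcongr
      · have : ‖u‖ = 0 := by
          by_contra hne
          have : 0 < ‖u‖ := lt_of_le_of_ne (norm_nonneg _) (Ne.symm hne)
          nlinarith
        have h' : ‖v‖ = 0 := le_antisymm (this ▸ hv') (norm_nonneg _)
        rw [this, h']) (by simp) (by simp)
  simpa [h0, pow_two, mul_assoc] using this

/-- For fixed X and Y, a function that is O(|u|²) has zero derivative at 0; the constant b(X, Y)
does not matter. -/
theorem fderiv_eq_zero_of_isBigO {G : E → F →L[ℝ] F →L[ℝ] ℝ} (hG : DifferentiableAt ℝ G 0)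
    {b : F → F → ℝ} (h : ∀ X Y, (fun u => G u X Y - b X Y) =O[𝓝 0] fun u => ‖u‖ ^ 2) :
    fderiv ℝ G 0 = 0 := by
  ext W X Y
  have h1 : HasFDerivAt (fun u => G u X Y - b X Y) (0 : E →L[ℝ] ℝ) 0 :=
    IsBigO.hasFDerivAt (n := 2) (by simpa using h X Y) (by norm_num)
  have h2 := h1.add_const (b X Y)
  simp only [sub_add_cancel] at h2
  rw [← fderiv_apply_apply hG, h2.fderiv]
  simp

/-- A smooth map with invertible derivative at `0` restricts to a diffeomorphism near `0`. -/
theorem exists_openPartialHomeomorph [CompleteSpace E] [CompleteSpace F] {ψ : E → F}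
    (hψ : ContDiff ℝ ∞ ψ) (hinv : (fderiv ℝ ψ 0).IsInvertible) :
    ∃ e : OpenPartialHomeomorph E F, (∀ u, e u = ψ u) ∧ 0 ∈ e.source ∧
      (∀ u ∈ e.source, (fderiv ℝ ψ u).IsInvertible) ∧ ContDiffOn ℝ ∞ e.symm e.target := by
  obtain ⟨L, hL⟩ := hinv
  have hs : HasFDerivAt ψ (L : E →L[ℝ] F) 0 := by
    rw [hL]
    exact (hψ.differentiable (by simp) 0).hasFDerivAt
  let e₀ := hψ.contDiffAt.toOpenPartialHomeomorph ψ hs (by simp)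
  -- Restricting to points with invertible derivative makes the local inverse smooth on its whole
  -- target, not only near the image of 0.
  have hopen : IsOpen {u : E | (fderiv ℝ ψ u).IsInvertible} := by
    rw [isOpen_iff_mem_nhds]
    intro u hu
    exact eventually_isInvertible (hψ.continuous_fderiv (by simp)).continuousAt hu
  refine ⟨e₀.restrOpen _ hopen, fun u => rfl, ⟨?_, ?_⟩, fun u hu => hu.2, ?_⟩
  · exact hψ.contDiffAt.mem_toOpenPartialHomeomorph_source hs (by simp)
  · exact ⟨L, hL⟩
  · intro v hv
    have hv' := (e₀.restrOpen _ hopen).map_target hv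
    obtain ⟨K, hK⟩ := hv'.2
    have hd : HasFDerivAt ψ (K : E →L[ℝ] F) ((e₀.restrOpen _ hopen).symm v) := by
      rw [hK]
      exact (hψ.differentiable (by simp) _).hasFDerivAt
    exact ((e₀.restrOpen _ hopen).contDiffAt_symm hv hd hψ.contDiffAt).contDiffWithinAt

end KahlerCondition

/-! ### Unitary frames -/

section HermitianBasis

/-- A Hermitian inner product on a real vector space with a complex structure is linearly isometric
to the standard one. -/
theorem exists_hermitian_equiv {V : Type*} [AddCommGroup V] [Module ℝ V] [FiniteDimensional ℝ V]
    {n : ℕ} (hn : Module.finrank ℝ V = 2 * n) (J : V →ₗ[ℝ] V) (hJJ : ∀ X, J (J X) = -X)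
    (B : V →ₗ[ℝ] V →ₗ[ℝ] ℝ) (hsym : ∀ X Y, B X Y = B Y X) (hJ : ∀ X Y, B (J X) (J Y) = B X Y)
    (hpos : ∀ X, X ≠ 0 → 0 < B X X) :
    ∃ L : EuclideanSpace ℂ (Fin n) ≃ₗ[ℝ] V, (∀ ξ, L (Complex.I • ξ) = J (L ξ)) ∧
      ∀ ξ η, B (L ξ) (L η) = ∑ a, ((starRingEnd ℂ) (ξ a) * η a).re := by
  have hJ2 : J * J = -1 := by
    ext X
    simp [hJJ]
  -- Since J² = -1, there is an algebra map ℂ → End(V) sending `i` to `J`.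
  let _ : Module ℂ V := Module.compHom V (Complex.lift ⟨J, hJ2⟩).toRingHom
  have hsmul : ∀ (c : ℂ) (X : V), c • X = c.re • X + c.im • J X := by
    intro c X
    change (Complex.lift ⟨J, hJ2⟩ c) X = _
    simp [Complex.lift_apply, Complex.liftAux_apply, Module.algebraMap_end_apply]
  have : IsScalarTower ℝ ℂ V := ⟨fun r c X => by
    rw [hsmul, hsmul]
    simp [smul_smul]⟩
  have : FiniteDimensional ℂ V := Module.Finite.of_restrictScalars_finite ℝ ℂ V
  have hnC : Module.finrank ℂ V = n := by
    have := Module.finrank_mul_finrank ℝ ℂ V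
    rw [hn, Complex.finrank_real_complex] at this
    omega
  have hskew : ∀ X Y, B (J X) Y = -B X (J Y) := by
    intro X Y
    rw [← hJ (J X) Y, hJJ]
    simp
  -- The Hermitian form with real part `B`, conjugate linear in the first argument; this fixes the
  -- sign of the imaginary part. An orthonormal basis for it gives the isometry.
  let core : InnerProductSpace.Core ℂ V :=
    { inner := fun X Y => ⟨B X Y, -B X (J Y)⟩
      conj_inner_symm := fun X Y => by
        apply Complex.ext
        · simp [hsym X Y]
        · simp [hsym X (J Y), hskew Y X]
      re_inner_nonneg := fun X => by
        by_cases h : X = 0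
        · simp [h]
        · exact (hpos X h).le
      add_left := fun X Y Z => by
        apply Complex.ext <;> simp [add_comm]
      smul_left := fun X Y r => by
        apply Complex.ext
        · simp [hsmul, hskew, sub_eq_add_neg]
        · simp [hsmul, hJ]
          ring
      definite := fun X h => by
        by_contra hne
        exact (hpos X hne).ne' (congrArg Complex.re h) }
  let _ : NormedAddCommGroup V := core.toNormedAddCommGroup
  let _ : InnerProductSpace ℂ V := InnerProductSpace.ofCore core.toCore
  let b := (stdOrthonormalBasis ℂ V).reindex (finCongr hnC)
  have hb : ∀ ξ η, inner ℂ (b.repr.symm ξ) (b.repr.symm η) = inner ℂ ξ η :=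
    fun ξ η => b.repr.symm.inner_map_map ξ η
  refine ⟨b.repr.symm.toLinearEquiv.restrictScalars ℝ, fun ξ => ?_, fun ξ η => ?_⟩
  · change b.repr.symm (Complex.I • ξ) = _
    rw [map_smul, hsmul]
    simp
  · have h := congrArg Complex.re (hb ξ η)
    simp only [PiLp.inner_apply, Complex.re_sum, RCLike.inner_apply] at h
    refine h.trans (Finset.sum_congr rfl fun a _ => ?_)
    rw [mul_comm]

end HermitianBasis

/-! ### Metric, curvature and Kähler form in arbitrary coordinates -/

section Charts

open Filter

set_option maxSynthPendingDepth 4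

variable {n : ℕ} {M : Type*} [TopologicalSpace M] [ChartedSpace (Model n) M]

variable {F : Type*} [NormedAddCommGroup F] [NormedSpace ℝ F] {E : Type*} [NormedAddCommGroup E]
  [NormedSpace ℝ E]

/-- Definiteness gives injectivity, and the dual has the same dimension. -/
theorem isInvertible_of_pos [FiniteDimensional ℝ F] (B : F →L[ℝ] F →L[ℝ] ℝ)
    (h : ∀ X, X ≠ 0 → 0 < B X X) : B.IsInvertible := by
  have hinj : Function.Injective (B : F →ₗ[ℝ] F →L[ℝ] ℝ) := by
    rw [injective_iff_map_eq_zero]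
    intro X hX
    by_contra hne
    have := h X hne
    rw [show B X = 0 from hX] at this
    simp at this
  have hfin : Module.finrank ℝ F = Module.finrank ℝ (F →L[ℝ] ℝ) := by
    rw [← (LinearMap.toContinuousLinearMap : (F →ₗ[ℝ] ℝ) ≃ₗ[ℝ] F →L[ℝ] ℝ).finrank_eq]
    exact Subspace.dual_finrank_eq.symm
  exact ⟨(LinearEquiv.ofInjectiveOfFinrankEq _ hinj hfin).toContinuousLinearEquiv, by ext; rfl⟩

/-- A family of alternating forms on a finite-dimensional space is differentiable if all of its
values are. -/
theorem differentiableAt_alternating [FiniteDimensional ℝ F] {k : ℕ}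
    {α : E → F [⋀^Fin k]→L[ℝ] ℝ} {u : E}
    (h : ∀ v, DifferentiableAt ℝ (fun w => α w v) u) : DifferentiableAt ℝ α u := by
  let b := Module.finBasis ℝ F
  let ι : F [⋀^Fin k]→L[ℝ] ℝ →ₗ[ℝ] ((Fin k → Fin (Module.finrank ℝ F)) → ℝ) :=
    { toFun := fun α s => α fun i => b (s i)
      map_add' := fun _ _ => rfl
      map_smul' := fun _ _ => rfl }
  have hι : Function.Injective ι := by
    intro α₁ α₂ h12
    apply ContinuousAlternatingMap.toAlternatingMap_injective
    exact b.ext_alternating fun s _ => congrFun h12 s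
  obtain ⟨g, hg⟩ := ι.exists_leftInverse_of_injective (LinearMap.ker_eq_bot.2 hι)
  have h1 : DifferentiableAt ℝ (fun w => ι (α w)) u :=
    differentiableAt_pi.2 fun s => h _
  have h2 : α = fun w => LinearMap.toContinuousLinearMap g (ι (α w)) := by
    funext w
    exact (congrArg (fun L => L (α w)) hg).symm
  rw [h2]
  exact (LinearMap.toContinuousLinearMap g).differentiableAt.comp u h1

variable (n) in
/-- Smooth coordinates on an open subset of `M`. -/
structure IsSmoothChart (e : OpenPartialHomeomorph M F) : Prop where
  smooth : ContMDiffOn (𝓡 (2 * n)) 𝓘(ℝ, F) ∞ e e.source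
  smooth_symm : ContMDiffOn 𝓘(ℝ, F) (𝓡 (2 * n)) ∞ e.symm e.target

theorem isSmoothChart_chartAt [IsManifold (𝓡 (2 * n)) ∞ M] (P : M) : IsSmoothChart n (chartAt (Model n) P) where
  smooth := contMDiffOn_chart
  smooth_symm := contMDiffOn_chart_symm

theorem AlmostHermitianStructure.IsHolomorphicChart.isSmoothChart
    [IsManifold (𝓡 (2 * n)) ∞ M] {S : AlmostHermitianStructure n M}
    {z : OpenPartialHomeomorph M (EuclideanSpace ℂ (Fin n))} (hz : S.IsHolomorphicChart z) :
    IsSmoothChart n z := ⟨hz.smooth, hz.smooth_symm⟩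

/-- All tangent spaces unfold to `Model n`, so one vector can be read at both points. This moves it
between base points that are equal but not definitionally equal. -/
theorem dChart_congr {e : OpenPartialHomeomorph M F} {p q : M} (h : p = q) (v : Model n) :
    dChart n e p v = dChart n e q v := by
  subst h
  rfl

namespace IsSmoothChart

variable {e : OpenPartialHomeomorph M F} {e' : OpenPartialHomeomorph M E}

theorem mdifferentiableAt (he : IsSmoothChart n e) {p : M} (hp : p ∈ e.source) :
    MDifferentiableAt (𝓡 (2 * n)) 𝓘(ℝ, F) e p :=
  ((he.smooth p hp).contMDiffAt (e.open_source.mem_nhds hp)).mdifferentiableAt (by simp)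

theorem mdifferentiableAt_symm (he : IsSmoothChart n e) {u : F} (hu : u ∈ e.target) :
    MDifferentiableAt 𝓘(ℝ, F) (𝓡 (2 * n)) e.symm u :=
  ((he.smooth_symm u hu).contMDiffAt (e.open_target.mem_nhds hu)).mdifferentiableAt (by simp)

theorem dChart_dSymm (he : IsSmoothChart n e) {u : F} (hu : u ∈ e.target) (X : F) :
    dChart n e (e.symm u) (dSymm n e u X) = X := by
  have h := (he.mdifferentiableAt (e.map_target hu)).hasMFDerivAt.comp u
    (he.mdifferentiableAt_symm hu).hasMFDerivAt
  have h' := (hasMFDerivAt_id (I := 𝓘(ℝ, F)) u).congr_of_eventuallyEq (f₁ := e ∘ e.symm)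
    (by filter_upwards [e.open_target.mem_nhds hu] with v hv using e.right_inv hv)
  exact congrArg (fun L : F →L[ℝ] F => L X) (hasMFDerivAt_unique h h')

theorem dSymm_dChart (he : IsSmoothChart n e) {p : M} (hp : p ∈ e.source)
    (v : TangentSpace (𝓡 (2 * n)) p) : (dSymm n e (e p) (dChart n e p v) : Model n) = v := by
  have h := (he.mdifferentiableAt_symm (e.map_source hp)).hasMFDerivAt.comp p
    (he.mdifferentiableAt hp).hasMFDerivAt
  have h' := (hasMFDerivAt_id (I := 𝓡 (2 * n)) p).congr_of_eventuallyEq (f₁ := e.symm ∘ e)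
    (by filter_upwards [e.open_source.mem_nhds hp] with v hv using e.left_inv hv)
  exact congrArg (fun L : Model n →L[ℝ] Model n => L v) (hasMFDerivAt_unique h h')

theorem contDiffAt_transition (he : IsSmoothChart n e) (he' : IsSmoothChart n e') {u : F}
    (hu : u ∈ e.target) (hu' : e.symm u ∈ e'.source) : ContDiffAt ℝ ∞ (e' ∘ e.symm) u :=
  (((he'.smooth _ hu').contMDiffAt (e'.open_source.mem_nhds hu')).comp u
    ((he.smooth_symm u hu).contMDiffAt (e.open_target.mem_nhds hu))).contDiffAt

theorem fderiv_transition (he : IsSmoothChart n e) (he' : IsSmoothChart n e') {u : F}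
    (hu : u ∈ e.target) (hu' : e.symm u ∈ e'.source) (X : F) :
    fderiv ℝ (e' ∘ e.symm) u X = dChart n e' (e.symm u) (dSymm n e u X) := by
  have h := mfderiv_comp u (he'.mdifferentiableAt hu') (he.mdifferentiableAt_symm hu)
  rw [mfderiv_eq_fderiv] at h
  exact congrArg (fun L : F →L[ℝ] E => L X) h

theorem fderiv_transition_dChart (he : IsSmoothChart n e) (he' : IsSmoothChart n e') {p : M}
    (hp : p ∈ e.source) (hp' : p ∈ e'.source) (v : TangentSpace (𝓡 (2 * n)) p) :
    fderiv ℝ (e' ∘ e.symm) (e p) (dChart n e p v) = dChart n e' p v := by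
  have h1 := e.left_inv hp
  rw [he.fderiv_transition he' (e.map_source hp) (by rwa [h1])]
  exact (dChart_congr h1 _).trans
    (congrArg (fun w : Model n => dChart n e' p w) (he.dSymm_dChart hp v))

theorem dSymm_transition (he : IsSmoothChart n e) (he' : IsSmoothChart n e') {u : F}
    (hu : u ∈ e.target) (hu' : e.symm u ∈ e'.source) (X : F) :
    (dSymm n e' ((e' ∘ e.symm) u) (fderiv ℝ (e' ∘ e.symm) u X) : Model n) = dSymm n e u X := by
  rw [fderiv_transition he he' hu hu']
  exact he'.dSymm_dChart hu' _

theorem fderiv_transition_fderiv_transition (he : IsSmoothChart n e) (he' : IsSmoothChart n e')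
    {p : M} (hp : p ∈ e.source) (hp' : p ∈ e'.source) (X : F) :
    fderiv ℝ (e ∘ e'.symm) (e' p) (fderiv ℝ (e' ∘ e.symm) (e p) X) = X := by
  have hpa : e.symm (e p) = p := e.left_inv hp
  have hpb : e'.symm (e' p) = p := e'.left_inv hp'
  have h1 := (he'.contDiffAt_transition he (e'.map_source hp') (by rwa [hpb])).differentiableAt
    (by simp)
  have h2 := (he.contDiffAt_transition he' (e.map_source hp) (by rwa [hpa])).differentiableAt
    (by simp)
  have h1' : DifferentiableAt ℝ (e ∘ e'.symm) ((e' ∘ e.symm) (e p)) := by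
    simpa [hpa] using h1
  have h := fderiv_comp (e p) h1' h2
  have h3 : (e ∘ e'.symm) ∘ (e' ∘ e.symm) =ᶠ[𝓝 (e p)] id := by
    have hc : ∀ᶠ v in 𝓝 (e p), e.symm v ∈ e'.source :=
      (e.continuousAt_symm (e.map_source hp)).eventually
        (e'.open_source.mem_nhds (by rwa [hpa]))
    filter_upwards [hc, e.open_target.mem_nhds (e.map_source hp)] with v hv hv'
    simp [e'.left_inv hv, e.right_inv hv']
  rw [h3.fderiv_eq, fderiv_id] at h
  have := congrArg (fun L : F →L[ℝ] F => L X) h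
  simpa [hpa] using this.symm

theorem isInvertible_fderiv_transition (he : IsSmoothChart n e) (he' : IsSmoothChart n e') {u : F}
    (hu : u ∈ e.target) (hu' : e.symm u ∈ e'.source) :
    (fderiv ℝ (e' ∘ e.symm) u).IsInvertible := by
  have e1 : e (e.symm u) = u := e.right_inv hu
  refine ContinuousLinearMap.IsInvertible.of_inverse (g := fderiv ℝ (e ∘ e'.symm) (e' (e.symm u)))
    ?_ ?_
  · ext X
    have := fderiv_transition_fderiv_transition he' he hu' (e.map_target hu) X
    rwa [e1] at this
  · ext X
    have := fderiv_transition_fderiv_transition he he' (e.map_target hu) hu' X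
    rwa [e1] at this

end IsSmoothChart

namespace AlmostHermitianStructure

variable [IsManifold (𝓡 (2 * n)) ∞ M] (S : AlmostHermitianStructure n M) {e : OpenPartialHomeomorph M F}
  {e' : OpenPartialHomeomorph M E}

theorem inner_congr {p q : M} (h : p = q) (v w : Model n) :
    S.g.inner p v w = S.g.inner q v w := by
  subst h
  rfl

theorem kahlerForm_congr {p q : M} (h : p = q) (v : Fin 2 → Model n) :
    S.kahlerForm p v = S.kahlerForm q v := by
  subst h
  rfl

theorem metricIn_transition (he : IsSmoothChart n e) (he' : IsSmoothChart n e') {u : F}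
    (hu : u ∈ e.target) (hu' : e.symm u ∈ e'.source) :
    S.metricIn e u = pullbackForm (e' ∘ e.symm) (S.metricIn e') u := by
  ext X Y
  rw [pullbackForm_apply, metricIn_apply, metricIn_apply]
  have h := S.inner_congr (show e'.symm ((e' ∘ e.symm) u) = e.symm u from e'.left_inv hu')
    (dSymm n e' ((e' ∘ e.symm) u) (fderiv ℝ (e' ∘ e.symm) u X))
    (dSymm n e' ((e' ∘ e.symm) u) (fderiv ℝ (e' ∘ e.symm) u Y))
  exact (h.trans (congrArg₂ (fun a b : Model n => S.g.inner (e.symm u) a b)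
    (he.dSymm_transition he' hu hu' X) (he.dSymm_transition he' hu hu' Y))).symm

theorem metricIn_symm (e : OpenPartialHomeomorph M F) (u X Y : F) :
    S.metricIn e u X Y = S.metricIn e u Y X := by
  rw [metricIn_apply, metricIn_apply, S.g.symm]

theorem metricIn_pos (he : IsSmoothChart n e) {u : F} (hu : u ∈ e.target) {X : F} (hX : X ≠ 0) :
    0 < S.metricIn e u X X := by
  rw [metricIn_apply]
  refine S.g.pos _ _ fun h => hX ?_
  rw [← he.dChart_dSymm hu X, h, map_zero]

/-- The coordinate fields are smooth sections, being images of constant fields under the tangent map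
of `e.symm`. The smooth metric is evaluated on them, and in finite dimension smoothness of all
values suffices. -/
theorem contDiffOn_metricIn [FiniteDimensional ℝ F] (he : IsSmoothChart n e) :
    ContDiffOn ℝ ∞ (S.metricIn e) e.target := by
  have hv : ∀ u ∈ e.target, ∀ X : F, ContMDiffAt 𝓘(ℝ, F) (𝓡 (2 * n)).tangent ∞
      (fun v : F => Bundle.TotalSpace.mk' (Model n)
        (E := fun p : M => TangentSpace (𝓡 (2 * n)) p) (e.symm v) (dSymm n e v X)) u := by
    intro u hu X
    have h1 := he.smooth_symm.contMDiffOn_tangentMapWithin (m := ∞) (n := ∞) (by simp)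
      e.open_target.uniqueMDiffOn
    have h2 : ContMDiff 𝓘(ℝ, F) 𝓘(ℝ, F).tangent ∞
        (fun v : F => (⟨v, X⟩ : TangentBundle 𝓘(ℝ, F) F)) :=
      contMDiff_vectorSpace_iff_contDiff.2 contDiff_const
    have h3 : ContMDiffOn 𝓘(ℝ, F) (𝓡 (2 * n)).tangent ∞
        (tangentMapWithin 𝓘(ℝ, F) (𝓡 (2 * n)) e.symm e.target ∘
          fun v : F => (⟨v, X⟩ : TangentBundle 𝓘(ℝ, F) F)) e.target :=
      h1.comp h2.contMDiffOn fun v hv => hv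
    refine (h3.contMDiffAt (e.open_target.mem_nhds hu)).congr_of_eventuallyEq ?_
    filter_upwards [e.open_target.mem_nhds hu] with v hv
    exact (tangentMapWithin_eq_tangentMap (p := (⟨v, X⟩ : TangentBundle 𝓘(ℝ, F) F))
      (e.open_target.uniqueMDiffOn v hv) (he.mdifferentiableAt_symm hv)).symm
  have hg : ∀ X Y : F, ContDiffOn ℝ ∞ (fun v => S.metricIn e v X Y) e.target := by
    intro X Y u hu
    have h := ContMDiffAt.clm_bundle_apply₂ (IB := 𝓡 (2 * n)) (F₁ := Model n) (F₂ := Model n)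
      (F₃ := ℝ) (E₁ := fun p : M => TangentSpace (𝓡 (2 * n)) p)
      (E₂ := fun p : M => TangentSpace (𝓡 (2 * n)) p) (E₃ := Bundle.Trivial M ℝ)
      (b := e.symm) (ψ := fun v => S.g.inner (e.symm v)) (S.g.contMDiff.contMDiffAt.comp u
      ((he.smooth_symm u hu).contMDiffAt (e.open_target.mem_nhds hu))) (hv u hu X) (hv u hu Y)
    rw [Bundle.contMDiffAt_totalSpace] at h
    exact h.2.contDiffAt.contDiffWithinAt
  exact contDiffOn_clm_apply.2 fun X => contDiffOn_clm_apply.2 fun Y => hg X Y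

theorem contDiffAt_metricIn [FiniteDimensional ℝ F] (he : IsSmoothChart n e) {u : F}
    (hu : u ∈ e.target) : ContDiffAt ℝ ∞ (S.metricIn e) u :=
  (S.contDiffOn_metricIn he).contDiffAt (e.open_target.mem_nhds hu)

theorem isInvertible_metricIn [FiniteDimensional ℝ F] (he : IsSmoothChart n e) {u : F}
    (hu : u ∈ e.target) : (S.metricIn e u).IsInvertible :=
  isInvertible_of_pos _ fun _ hX => S.metricIn_pos he hu hX

/-- The Riemann curvature tensor may be computed in any coordinate system. -/
theorem riemann_eq [FiniteDimensional ℝ F] (he : IsSmoothChart n e) {P : M} (hP : P ∈ e.source)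
    (x y z w : TangentSpace (𝓡 (2 * n)) P) :
    S.riemann P x y z w = curvatureTensor (S.metricIn e) (e P) (dChart n e P x) (dChart n e P y)
      (dChart n e P z) (dChart n e P w) := by
  have hc := isSmoothChart_chartAt (n := n) P
  set c := chartAt (Model n) P with hcdef
  have hPc : P ∈ c.source := mem_chart_source _ P
  have hcP : c.symm (c P) = P := c.left_inv hPc
  have ht : c P ∈ c.target := c.map_source hPc
  have heq : S.metricIn c =ᶠ[𝓝 (c P)] pullbackForm (e ∘ c.symm) (S.metricIn e) := by
    filter_upwards [c.open_target.mem_nhds ht, (c.continuousAt_symm ht).eventually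
      (e.open_source.mem_nhds (by rwa [hcP]))] with v hv hv'
    exact S.metricIn_transition hc he hv hv'
  have hψ : (e ∘ c.symm) (c P) = e P := congrArg e hcP
  have hd : ∀ v : TangentSpace (𝓡 (2 * n)) P,
      fderiv ℝ (e ∘ c.symm) (c P) (dChart n c P v) = dChart n e P v :=
    hc.fderiv_transition_dChart he hPc hP
  rw [riemann, curvatureTensor_congr heq, curvatureTensor_pullbackForm
    ((hc.contDiffAt_transition he ht (by rwa [hcP])).of_le ENat.LEInfty.out)
    ((S.contDiffAt_metricIn he (by rw [hψ]; exact e.map_source hP)).of_le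
      ENat.LEInfty.out)
    (hc.isInvertible_fderiv_transition he ht (by rwa [hcP]))
    (S.isInvertible_metricIn he (by rw [hψ]; exact e.map_source hP))
    (Eventually.of_forall fun v => S.metricIn_symm e v), hψ, hd, hd, hd, hd]

section Complex

variable {J : F →L[ℝ] F}

theorem J_dSymm (he : IsSmoothChart n e)
    (hJ : ∀ p ∈ e.source, ∀ v, dChart n e p (S.J p v) = J (dChart n e p v)) {u : F}
    (hu : u ∈ e.target) (X : F) : S.J (e.symm u) (dSymm n e u X) = dSymm n e u (J X) := by
  have hp := e.map_target hu
  have h1 : dChart n e (e.symm u) (S.J (e.symm u) (dSymm n e u X)) =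
      dChart n e (e.symm u) (dSymm n e u (J X)) := by
    rw [hJ _ hp, he.dChart_dSymm hu, he.dChart_dSymm hu]
  have h2 := he.dSymm_dChart hp (S.J (e.symm u) (dSymm n e u X))
  have h3 := he.dSymm_dChart hp (dSymm n e u (J X))
  rw [h1] at h2
  exact h2.symm.trans h3

theorem kahlerFormIn_apply (he : IsSmoothChart n e)
    (hJ : ∀ p ∈ e.source, ∀ v, dChart n e p (S.J p v) = J (dChart n e p v)) {u : F}
    (hu : u ∈ e.target) (v : Fin 2 → F) :
    S.kahlerFormIn e u v = S.metricIn e u (v 0) (J (v 1)) := by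
  rw [metricIn_apply, ← S.J_dSymm he hJ hu]
  rfl

theorem metricIn_J (he : IsSmoothChart n e)
    (hJ : ∀ p ∈ e.source, ∀ v, dChart n e p (S.J p v) = J (dChart n e p v)) {u : F}
    (hu : u ∈ e.target) (X Y : F) : S.metricIn e u (J X) (J Y) = S.metricIn e u X Y := by
  rw [metricIn_apply, metricIn_apply, ← S.J_dSymm he hJ hu, ← S.J_dSymm he hJ hu, S.J_isometry]

variable [FiniteDimensional ℝ F]

theorem differentiableAt_metricIn (he : IsSmoothChart n e) {u : F}
    (hu : u ∈ e.target) : DifferentiableAt ℝ (S.metricIn e) u :=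
  (S.contDiffAt_metricIn he hu).differentiableAt (by simp)

theorem differentiableAt_kahlerFormIn_apply (he : IsSmoothChart n e)
    (hJ : ∀ p ∈ e.source, ∀ v, dChart n e p (S.J p v) = J (dChart n e p v)) {u : F}
    (hu : u ∈ e.target) (v : Fin 2 → F) :
    DifferentiableAt ℝ (fun w => S.kahlerFormIn e w v) u := by
  have h : (fun w => S.kahlerFormIn e w v) =ᶠ[𝓝 u] fun w => S.metricIn e w (v 0) (J (v 1)) := by
    filter_upwards [e.open_target.mem_nhds hu] with w hw
    exact S.kahlerFormIn_apply he hJ hw v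
  refine h.differentiableAt_iff.2 ?_
  exact ((S.differentiableAt_metricIn he hu).clm_apply (differentiableAt_const _)).clm_apply
    (differentiableAt_const _)

theorem differentiableAt_kahlerFormIn (he : IsSmoothChart n e)
    (hJ : ∀ p ∈ e.source, ∀ v, dChart n e p (S.J p v) = J (dChart n e p v)) {u : F}
    (hu : u ∈ e.target) : DifferentiableAt ℝ (S.kahlerFormIn e) u :=
  differentiableAt_alternating fun v => S.differentiableAt_kahlerFormIn_apply he hJ hu v

/-- As `J` is constant in these coordinates, only the metric is differentiated. -/
theorem extDeriv_kahlerFormIn (he : IsSmoothChart n e)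
    (hJ : ∀ p ∈ e.source, ∀ v, dChart n e p (S.J p v) = J (dChart n e p v)) {u : F}
    (hu : u ∈ e.target) (v : Fin 3 → F) :
    extDeriv (S.kahlerFormIn e) u v = fderiv ℝ (S.metricIn e) u (v 0) (v 1) (J (v 2))
      - fderiv ℝ (S.metricIn e) u (v 1) (v 0) (J (v 2))
      + fderiv ℝ (S.metricIn e) u (v 2) (v 0) (J (v 1)) := by
  have h : ∀ (v : Fin 2 → F) (W : F), fderiv ℝ (fun w => S.kahlerFormIn e w v) u W =
      fderiv ℝ (S.metricIn e) u W (v 0) (J (v 1)) := by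
    intro v W
    rw [← fderiv_apply_apply (S.differentiableAt_metricIn he hu)]
    refine congrArg (fun L : F →L[ℝ] ℝ => L W) (Filter.EventuallyEq.fderiv_eq ?_)
    filter_upwards [e.open_target.mem_nhds hu] with w hw
    exact S.kahlerFormIn_apply he hJ hw v
  rw [extDeriv_apply (S.differentiableAt_kahlerFormIn he hJ hu)]
  simp only [h]
  rw [Fin.sum_univ_three]
  simp [Fin.removeNth, Fin.succAbove]
  ring

/-- The exterior derivative of the Kähler form may be computed in any holomorphic coordinates. -/
theorem dKahler_eq (he : IsSmoothChart n e)
    (hJ : ∀ p ∈ e.source, ∀ v, dChart n e p (S.J p v) = J (dChart n e p v)) {P : M}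
    (hP : P ∈ e.source) (v : Fin 3 → TangentSpace (𝓡 (2 * n)) P) :
    S.dKahler P v = extDeriv (S.kahlerFormIn e) (e P) fun i => dChart n e P (v i) := by
  have hc := isSmoothChart_chartAt (n := n) P
  set c := chartAt (Model n) P with hcdef
  have hPc : P ∈ c.source := mem_chart_source _ P
  have hcP : c.symm (c P) = P := c.left_inv hPc
  have ht : c P ∈ c.target := c.map_source hPc
  -- In the preferred chart `c` the complex structure need not be constant, so Ω is written there as
  -- the pullback of its expression in `e`; the exterior derivative commutes with pullback.
  have heq : S.kahlerFormIn c =ᶠ[𝓝 (c P)] fun u =>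
      (S.kahlerFormIn e ((e ∘ c.symm) u)).compContinuousLinearMap (fderiv ℝ (e ∘ c.symm) u) := by
    filter_upwards [c.open_target.mem_nhds ht, (c.continuousAt_symm ht).eventually
      (e.open_source.mem_nhds (by rwa [hcP]))] with u hu hu'
    ext v
    have h := S.kahlerForm_congr (show e.symm ((e ∘ c.symm) u) = c.symm u from e.left_inv hu')
      (fun i => dSymm n e ((e ∘ c.symm) u) (fderiv ℝ (e ∘ c.symm) u (v i)))
    have h' : (fun i => (dSymm n e ((e ∘ c.symm) u) (fderiv ℝ (e ∘ c.symm) u (v i)) : Model n)) =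
        fun i => dSymm n c u (v i) := funext fun i => hc.dSymm_transition he hu hu' (v i)
    exact (h.trans (congrArg (fun w : Fin 2 → Model n => S.kahlerForm (c.symm u) w) h')).symm
  have hψ : (e ∘ c.symm) (c P) = e P := congrArg e hcP
  have hd : ∀ v : TangentSpace (𝓡 (2 * n)) P,
      fderiv ℝ (e ∘ c.symm) (c P) (dChart n c P v) = dChart n e P v :=
    hc.fderiv_transition_dChart he hPc hP
  rw [dKahler, heq.extDeriv_eq, extDeriv_pullback (r := ∞)
    (S.differentiableAt_kahlerFormIn he hJ (by rw [hψ]; exact e.map_source hP))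
    (hc.contDiffAt_transition he ht (by rwa [hcP])) (by
      rw [minSmoothness_of_isRCLikeNormedField]
      exact ENat.LEInfty.out), hψ]
  exact congrArg _ (funext fun i => hd (v i))

theorem dKahler_eq_zero_iff (he : IsSmoothChart n e)
    (hJ : ∀ p ∈ e.source, ∀ v, dChart n e p (S.J p v) = J (dChart n e p v)) {P : M}
    (hP : P ∈ e.source) :
    S.dKahler P = 0 ↔ ∀ X Y Z, fderiv ℝ (S.metricIn e) (e P) X Y (J Z)
      - fderiv ℝ (S.metricIn e) (e P) Y X (J Z)
      + fderiv ℝ (S.metricIn e) (e P) Z X (J Y) = 0 := by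
  have ht := e.map_source hP
  constructor
  · intro h X Y Z
    have hs : ∀ X : F, ∃ v : TangentSpace (𝓡 (2 * n)) P, dChart n e P v = X := by
      intro X
      refine ⟨(dSymm n e (e P) X : Model n), ?_⟩
      exact (dChart_congr (e.left_inv hP) _).symm.trans (he.dChart_dSymm ht X)
    obtain ⟨x, rfl⟩ := hs X
    obtain ⟨y, rfl⟩ := hs Y
    obtain ⟨z, rfl⟩ := hs Z
    have := S.dKahler_eq he hJ hP ![x, y, z]
    rw [h, S.extDeriv_kahlerFormIn he hJ ht] at this
    exact this.symm
  · intro h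
    ext v
    rw [S.dKahler_eq he hJ hP, S.extDeriv_kahlerFormIn he hJ ht, h]
    rfl

end Complex

end AlmostHermitianStructure

end Charts

/-! ### Osculating holomorphic coordinates -/

section NormalCoordinates

open Filter Asymptotics

set_option maxSynthPendingDepth 4

variable {n : ℕ}

variable (n) in
/-- Multiplication by `i` on `ℂⁿ` as a real linear map. -/
def mulI : EuclideanSpace ℂ (Fin n) →L[ℝ] EuclideanSpace ℂ (Fin n) :=
  (Complex.I • ContinuousLinearMap.id ℂ (EuclideanSpace ℂ (Fin n))).restrictScalars ℝ

theorem mulI_apply (X : EuclideanSpace ℂ (Fin n)) : mulI n X = Complex.I • X := rfl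

theorem mulI_mulI (X : EuclideanSpace ℂ (Fin n)) : mulI n (mulI n X) = -X := by
  rw [mulI_apply, mulI_apply, smul_smul, Complex.I_mul_I, neg_one_smul]

variable {M : Type*} [TopologicalSpace M] [ChartedSpace (Model n) M]
  [IsManifold (𝓡 (2 * n)) ∞ M]

theorem AlmostHermitianStructure.IsHolomorphicChart.dChart_J {S : AlmostHermitianStructure n M}
    {z : OpenPartialHomeomorph M (EuclideanSpace ℂ (Fin n))} (hz : S.IsHolomorphicChart z)
    (p : M) (hp : p ∈ z.source) (v : TangentSpace (𝓡 (2 * n)) p) :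
    dChart n z p (S.J p v) = mulI n (dChart n z p v) :=
  hz.map_J p hp v

/-- Coordinates are osculating at `P` if the metric is standard there to second order. -/
def AlmostHermitianStructure.IsOsculating (S : AlmostHermitianStructure n M) (P : M)
    (z : OpenPartialHomeomorph M (EuclideanSpace ℂ (Fin n))) : Prop :=
  S.IsHolomorphicChart z ∧ P ∈ z.source ∧ z P = 0 ∧
    ∀ ξ η : EuclideanSpace ℂ (Fin n),
      (fun u : EuclideanSpace ℂ (Fin n) =>
        S.metricIn z u ξ η - ∑ a, ((starRingEnd ℂ) (ξ a) * η a).re) =O[𝓝 0] (fun u => ‖u‖ ^ 2)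

theorem AlmostHermitianStructure.IsOsculating.fderiv_metricIn {S : AlmostHermitianStructure n M}
    {P : M} {z : OpenPartialHomeomorph M (EuclideanSpace ℂ (Fin n))} (h : S.IsOsculating P z) :
    fderiv ℝ (S.metricIn z) (z P) = 0 := by
  obtain ⟨hz, hP, h0, hO⟩ := h
  have ht := z.map_source hP
  have hd := S.differentiableAt_metricIn hz.isSmoothChart ht
  rw [h0] at hd ⊢
  exact fderiv_eq_zero_of_isBigO hd hO

theorem AlmostHermitianStructure.IsOsculating.dKahler_eq_zero {S : AlmostHermitianStructure n M}
    {P : M} {z : OpenPartialHomeomorph M (EuclideanSpace ℂ (Fin n))} (h : S.IsOsculating P z) :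
    S.dKahler P = 0 := by
  rw [S.dKahler_eq_zero_iff h.1.isSmoothChart h.1.dChart_J h.2.1, h.fderiv_metricIn]
  simp

/-- Postcomposing a holomorphic chart with the inverse of a biholomorphism. -/
theorem AlmostHermitianStructure.IsHolomorphicChart.trans_symm {S : AlmostHermitianStructure n M}
    {z : OpenPartialHomeomorph M (EuclideanSpace ℂ (Fin n))} (hz : S.IsHolomorphicChart z)
    {e : OpenPartialHomeomorph (EuclideanSpace ℂ (Fin n)) (EuclideanSpace ℂ (Fin n))}
    (he : ContDiffOn ℝ ∞ e e.source) (he' : ContDiffOn ℝ ∞ e.symm e.target)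
    (hinv : ∀ u ∈ e.source, (fderiv ℝ e u).IsInvertible)
    (hI : ∀ u ∈ e.source, ∀ X, fderiv ℝ e u (mulI n X) = mulI n (fderiv ℝ e u X)) :
    S.IsHolomorphicChart (z.trans e.symm) := by
  have hs : IsSmoothChart n (z.trans e.symm) := by
    constructor
    · exact he'.contMDiffOn.comp (hz.smooth.mono fun p hp => hp.1) fun p hp => hp.2
    · exact hz.smooth_symm.comp (he.contMDiffOn.mono fun p hp => hp.1) fun p hp => hp.2
  refine ⟨hs.smooth, hs.smooth_symm, fun p hp v => ?_⟩
  have hp1 : p ∈ z.source := hp.1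
  have hp2 : (z.trans e.symm) p ∈ e.source := e.map_target hp.2
  have heq : z ∘ (z.trans e.symm).symm =ᶠ[𝓝 ((z.trans e.symm) p)] e := by
    filter_upwards [(z.trans e.symm).open_target.mem_nhds ((z.trans e.symm).map_source hp)]
      with u hu
    exact z.right_inv hu.2
  have key : ∀ w : TangentSpace (𝓡 (2 * n)) p, fderiv ℝ e ((z.trans e.symm) p)
      (dChart n (z.trans e.symm) p w) = dChart n z p w := by
    intro w
    rw [← heq.fderiv_eq]
    exact hs.fderiv_transition_dChart hz.isSmoothChart hp hp1 w
  -- Complex linearity of the differential of `e.symm` is tested after applying the injective,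
  -- complex linear differential of `e`.
  apply (hinv _ hp2).injective
  rw [key, hz.dChart_J p hp1, ← mulI_apply, hI _ hp2, key]

/-- If the Kähler form is closed at `P`, there are osculating holomorphic coordinates at `P`. -/
theorem HermitianStructure.exists_isOsculating (S : HermitianStructure n M) {P : M}
    (hP : S.dKahler P = 0) :
    ∃ z : OpenPartialHomeomorph M (EuclideanSpace ℂ (Fin n)), S.IsOsculating P z := by
  obtain ⟨z₀, hz, hPz⟩ := S.integrable P
  have hs := hz.isSmoothChart
  have ht := z₀.map_source hPz
  set G := S.metricIn z₀ with hGdef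
  set c := z₀ P with hcdef
  have hG : ContDiffAt ℝ ∞ G c := S.contDiffAt_metricIn hs ht
  have hGd : DifferentiableAt ℝ G c := S.differentiableAt_metricIn hs ht
  have hinv : (G c).IsInvertible := S.isInvertible_metricIn hs ht
  have hsym : ∀ᶠ v in 𝓝 c, ∀ X Y, G v X Y = G v Y X :=
    Eventually.of_forall fun v => S.metricIn_symm z₀ v
  have hJ : ∀ᶠ v in 𝓝 c, ∀ X Y, G v (mulI n X) (mulI n Y) = G v X Y := by
    filter_upwards [z₀.open_target.mem_nhds ht] with v hv
    exact S.metricIn_J hs hz.dChart_J hv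
  -- The only use of dΩ(P) = 0: it makes the quadratic correction in `normalMap` holomorphic.
  have hΓ := christoffelCLM_complexLinear hGd hinv mulI_mulI hJ
    ((S.dKahler_eq_zero_iff hs hz.dChart_J hPz).1 hP)
  have hfin : Module.finrank ℝ (EuclideanSpace ℂ (Fin n)) = 2 * n := by
    rw [finrank_real_of_complex]
    simp
  obtain ⟨L₀, hL₀I, hL₀⟩ := exists_hermitian_equiv hfin (mulI n).toLinearMap mulI_mulI
    (ContinuousLinearMap.coeLM ℝ ∘ₗ (G c).toLinearMap) hsym.self_of_nhds hJ.self_of_nhds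
    (fun X hX => S.metricIn_pos hs ht hX)
  let L := L₀.toContinuousLinearEquiv
  have hψinv : (fderiv ℝ (normalMap G c (L : EuclideanSpace ℂ (Fin n) →L[ℝ] _)) 0).IsInvertible := by
    rw [fderiv_normalMap_zero hGd hsym hinv]
    exact ContinuousLinearMap.isInvertible_equiv
  have hψ : ContDiff ℝ ∞ (normalMap G c (L : EuclideanSpace ℂ (Fin n) →L[ℝ] _)) :=
    contDiff_quadraticMap _ _ _
  obtain ⟨e, he, he0, hei, hes⟩ := exists_openPartialHomeomorph hψ hψinv
  have hefun : (e : EuclideanSpace ℂ (Fin n) → EuclideanSpace ℂ (Fin n)) = normalMap G c L :=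
    funext he
  have hec : e 0 = c := by rw [he, normalMap_zero]
  have hc' : c ∈ e.target := hec ▸ e.map_source he0
  have hz' : S.IsHolomorphicChart (z₀.trans e.symm) := by
    refine hz.trans_symm ?_ hes ?_ ?_
    · rw [hefun]
      exact hψ.contDiffOn
    · rwa [hefun]
    · intro u _ X
      rw [hefun, fderiv_normalMap hGd hsym hinv, fderiv_normalMap hGd hsym hinv]
      have hLI : (L : EuclideanSpace ℂ (Fin n) →L[ℝ] _) (mulI n X) = mulI n (L X) := hL₀I X
      rw [hLI, hΓ, map_sub]
      rfl
  have hPz' : P ∈ (z₀.trans e.symm).source := ⟨hPz, hc'⟩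
  have hz0 : (z₀.trans e.symm) P = 0 := by
    change e.symm c = 0
    rw [← hec, e.left_inv he0]
  refine ⟨z₀.trans e.symm, hz', hPz', hz0, fun ξ η => ?_⟩
  have ht' : (0 : EuclideanSpace ℂ (Fin n)) ∈ (z₀.trans e.symm).target :=
    hz0 ▸ (z₀.trans e.symm).map_source hPz'
  have heq : z₀ ∘ (z₀.trans e.symm).symm =ᶠ[𝓝 0] normalMap G c L := by
    filter_upwards [(z₀.trans e.symm).open_target.mem_nhds ht'] with u hu
    rw [← he]
    exact z₀.right_inv hu.2
  have hmet : S.metricIn (z₀.trans e.symm) =ᶠ[𝓝 0] pullbackForm (normalMap G c L) G := by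
    filter_upwards [(z₀.trans e.symm).open_target.mem_nhds ht', heq.eventuallyEq_nhds] with u hu hu'
    rw [S.metricIn_transition hz'.isSmoothChart hs hu
      (((z₀.trans e.symm).map_target hu).1)]
    simp only [pullbackForm, hu'.fderiv_eq, hu'.eq_of_nhds, hGdef]
  have hG' := S.contDiffAt_metricIn hz'.isSmoothChart ht'
  have hGd' := S.differentiableAt_metricIn hz'.isSmoothChart ht'
  -- The value at 0 is standard since `L` is unitary for `G c`, and the first derivative vanishes by
  -- the choice of the quadratic term.
  refine isBigO_norm_sq_of_fderiv_eq_zero ?_ ?_ ?_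
  · exact (((hG'.of_le ENat.LEInfty.out).clm_apply contDiffAt_const).clm_apply
      contDiffAt_const).sub contDiffAt_const
  · rw [hmet.eq_of_nhds, pullbackForm_apply, fderiv_normalMap_zero hGd hsym hinv, normalMap_zero,
      ← hL₀]
    exact sub_self _
  · rw [fderiv_sub_const]
    ext W
    rw [fderiv_apply_apply hGd', hmet.fderiv_eq,
      fderiv_pullbackForm_normalMap (hG.of_le ENat.LEInfty.out) hsym hinv]
    rfl

end NormalCoordinates

/-! ### Symmetries of the Hessian of a Hermitian metric -/

section Hessian

open Filter

set_option maxSynthPendingDepth 4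

variable {F : Type*} [NormedAddCommGroup F] [NormedSpace ℝ F]

theorem fderiv_fderiv_apply {G : F → F →L[ℝ] F →L[ℝ] ℝ} {u : F} (hG : ContDiffAt ℝ 2 G u)
    (V : F) : DifferentiableAt ℝ (fun v => fderiv ℝ G v V) u ∧
      ∀ W, fderiv ℝ (fun v => fderiv ℝ G v V) u W = fderiv ℝ (fderiv ℝ G) u W V := by
  have hd : HasFDerivAt (fderiv ℝ G) (fderiv ℝ (fderiv ℝ G) u) u :=
    ((hG.fderiv_right (m := 1) (by norm_num)).differentiableAt (by simp)).hasFDerivAt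
  have h := hd.clm_apply (hasFDerivAt_const V u)
  refine ⟨h.differentiableAt, fun W => ?_⟩
  rw [h.fderiv]
  simp

/-- The symmetry passes to first derivatives throughout a neighbourhood, so it can be differentiated
once more. -/
theorem fderiv_fderiv_symm {G : F → F →L[ℝ] F →L[ℝ] ℝ} {u : F} (hG : ContDiffAt ℝ 2 G u)
    (hsym : ∀ᶠ v in 𝓝 u, ∀ X Y, G v X Y = G v Y X) (W V X Y : F) :
    fderiv ℝ (fderiv ℝ G) u W V X Y = fderiv ℝ (fderiv ℝ G) u W V Y X := by
  obtain ⟨hd, he⟩ := fderiv_fderiv_apply hG V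
  rw [← he]
  refine fderiv_symm hd ?_ W X Y
  filter_upwards [hG.eventually (by simp), hsym.eventually_nhds] with v hv hv' X Y
  exact fderiv_symm (hv.differentiableAt (by simp)) hv' V X Y

theorem fderiv_fderiv_invariant {G : F → F →L[ℝ] F →L[ℝ] ℝ} {u : F} (hG : ContDiffAt ℝ 2 G u)
    {J : F →L[ℝ] F} (hJ : ∀ᶠ v in 𝓝 u, ∀ X Y, G v (J X) (J Y) = G v X Y) (W V X Y : F) :
    fderiv ℝ (fderiv ℝ G) u W V (J X) (J Y) = fderiv ℝ (fderiv ℝ G) u W V X Y := by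
  obtain ⟨hd, he⟩ := fderiv_fderiv_apply hG V
  rw [← he]
  refine fderiv_invariant hd ?_ W X Y
  filter_upwards [hG.eventually (by simp), hJ.eventually_nhds] with v hv hv' X Y
  exact fderiv_invariant (hv.differentiableAt (by simp)) hv' V X Y

end Hessian

/-! ### Curvature at a point with dΩ = 0 lies in 𝔏 -/

section CurvatureRange

set_option maxSynthPendingDepth 4

variable {V : Type*} [NormedAddCommGroup V] [InnerProductSpace ℝ V]

/-- The 4-tensor `(a, b, c, d) ↦ ½ T(ℓ c, ℓ d, ℓ a, ℓ b)`. -/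
def tensorOf {F : Type*} [NormedAddCommGroup F] [NormedSpace ℝ F]
    (T : F →L[ℝ] F →L[ℝ] F →L[ℝ] F →L[ℝ] ℝ) (l : V →ₗ[ℝ] F) : Tensor4 V where
  toFun v := 1 / 2 * T (l (v 2)) (l (v 3)) (l (v 0)) (l (v 1))
  map_update_add' := by
    intro inst v i x y
    obtain rfl : inst = instDecidableEqFin 4 := Subsingleton.elim _ _
    fin_cases i <;> simp [mul_add]
  map_update_smul' := by
    intro inst v i c x
    obtain rfl : inst = instDecidableEqFin 4 := Subsingleton.elim _ _
    fin_cases i <;> simp [mul_left_comm]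

theorem tensorOf_apply {F : Type*} [NormedAddCommGroup F] [NormedSpace ℝ F]
    (T : F →L[ℝ] F →L[ℝ] F →L[ℝ] F →L[ℝ] ℝ) (l : V →ₗ[ℝ] F) (a b c d : V) :
    tensorOf T l ![a, b, c, d] = 1 / 2 * T (l c) (l d) (l a) (l b) := rfl

theorem mem_curvRange_iff (J : HermitianComplexStructure V) (A : algCurv V) :
    A ∈ curvRange J ↔ ∃ Θ ∈ symPlusTensorSym J, ∀ x y z w,
      A.1 ![x, y, z, w] = Θ ![x, z, y, w] + Θ ![y, w, x, z] - Θ ![x, w, y, z] - Θ ![y, z, x, w] := by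
  constructor
  · rintro ⟨Θ, rfl⟩
    exact ⟨Θ.1, Θ.2, fun x y z w => curvOf_apply Θ.1 x y z w⟩
  · rintro ⟨Θ, hΘ, h⟩
    refine ⟨⟨Θ, hΘ⟩, Subtype.ext (MultilinearMap.ext fun v => ?_)⟩
    have hv : v = ![v 0, v 1, v 2, v 3] := by
      funext i
      fin_cases i <;> rfl
    rw [hv, h]
    exact curvOf_apply Θ _ _ _ _

/-- The curvature of a Hermitian manifold at a point where the Kähler form is closed. -/
theorem mem_curvRange_of_realizes {n : ℕ} {M : Type*} [TopologicalSpace M]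
    [ChartedSpace (Model n) M] [IsManifold (𝓡 (2 * n)) ∞ M] (S : HermitianStructure n M) {P : M}
    (hP : S.dKahler P = 0) (J : HermitianComplexStructure V) {A : algCurv V}
    (h : S.Realizes P J A) : A ∈ curvRange J := by
  obtain ⟨z, hz⟩ := S.exists_isOsculating hP
  obtain ⟨φ, -, hφJ, hφA⟩ := h
  have hs := hz.1.isSmoothChart
  have ht := z.map_source hz.2.1
  have hG : ContDiffAt ℝ 2 (S.metricIn z) (z P) :=
    (S.contDiffAt_metricIn hs ht).of_le ENat.LEInfty.out
  have hsym : ∀ᶠ v in 𝓝 (z P), ∀ X Y, S.metricIn z v X Y = S.metricIn z v Y X :=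
    Filter.Eventually.of_forall fun v => S.metricIn_symm z v
  have hJ : ∀ᶠ v in 𝓝 (z P), ∀ X Y, S.metricIn z v (mulI n X) (mulI n Y) = S.metricIn z v X Y := by
    filter_upwards [z.open_target.mem_nhds ht] with v hv
    exact S.metricIn_J hs hz.1.dChart_J hv
  let l : V →ₗ[ℝ] EuclideanSpace ℂ (Fin n) := (dChart n z P).toLinearMap ∘ₗ φ.toLinearMap
  have hl : ∀ x, l (J.J x) = mulI n (l x) := by
    intro x
    change dChart n z P (φ (J.J x)) = _
    rw [hφJ, hz.1.dChart_J P hz.2.1]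
    rfl
  rw [mem_curvRange_iff]
  -- The ½ in `tensorOf` is the one in the curvature formula. The directions of differentiation come
  -- last, where no J-invariance is required.
  refine ⟨tensorOf (fderiv ℝ (fderiv ℝ (S.metricIn z)) (z P)) l, ⟨?_, ?_, ?_⟩, ?_⟩
  · intro x y z w
    rw [tensorOf_apply, tensorOf_apply, fderiv_fderiv_symm hG hsym]
  · intro x y z w
    rw [tensorOf_apply, tensorOf_apply, hl, hl, fderiv_fderiv_invariant hG hJ]
  · intro x y z w
    rw [tensorOf_apply, tensorOf_apply, (hG.isSymmSndFDerivAt (by simp)).eq]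
  · intro x y z w
    rw [hφA, S.riemann_eq hs hz.2.1, curvatureTensor_of_fderiv_eq_zero hG
      (S.isInvertible_metricIn hs ht) hz.fderiv_metricIn]
    simp only [tensorOf_apply]
    rw [← mul_add, ← mul_sub, ← mul_sub]
    rfl

end CurvatureRange

/-! ### Hermitian structures on a manifold with one global chart -/

section GlobalChart

open Filter Bundle

set_option maxSynthPendingDepth 4

variable {n : ℕ} {M : Type*} [TopologicalSpace M] [ChartedSpace (Model n) M]
  [IsManifold (𝓡 (2 * n)) ∞ M]

/-- Every transition is that of a chart with itself. Hence the tangent bundle is trivialized by the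
identity, and smoothness of tensor fields reduces to that of ordinary functions. -/
theorem coordChange_of_const_chart (hc : ∀ p q : M, chartAt (Model n) p = chartAt (Model n) q)
    (p q x : M) : (tangentBundleCore (𝓡 (2 * n)) M).coordChange (achart (Model n) p)
      (achart (Model n) q) x = ContinuousLinearMap.id ℝ (Model n) := by
  have h1 : achart (Model n) p = achart (Model n) x := Subtype.ext (hc p x)
  have h2 : achart (Model n) q = achart (Model n) x := Subtype.ext (hc q x)
  ext v : 1
  rw [h1, h2]
  exact (tangentBundleCore (𝓡 (2 * n)) M).coordChange_self _ _ (mem_chart_source _ x) v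

theorem continuousLinearMapAt_of_const_chart
    (hc : ∀ p q : M, chartAt (Model n) p = chartAt (Model n) q) (p x : M) :
    (trivializationAt (Model n) (TangentSpace (𝓡 (2 * n))) p).continuousLinearMapAt ℝ x =
      ContinuousLinearMap.id ℝ (Model n) := by
  have hx : x ∈ (chartAt (Model n) p).source := hc p x ▸ mem_chart_source _ x
  rw [TangentBundle.continuousLinearMapAt_trivializationAt_eq_core hx]
  exact coordChange_of_const_chart hc x p x

theorem symmL_of_const_chart
    (hc : ∀ p q : M, chartAt (Model n) p = chartAt (Model n) q) (p x : M) :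
    (trivializationAt (Model n) (TangentSpace (𝓡 (2 * n))) p).symmL ℝ x =
      ContinuousLinearMap.id ℝ (Model n) := by
  have hx : x ∈ (chartAt (Model n) p).source := hc p x ▸ mem_chart_source _ x
  rw [TangentBundle.symmL_trivializationAt_eq_core hx]
  exact coordChange_of_const_chart hc p x x

theorem contMDiff_endomorphism_of_const_chart
    (hc : ∀ p q : M, chartAt (Model n) p = chartAt (Model n) q)
    {K : M → Model n →L[ℝ] Model n}
    (hK : ContMDiff (𝓡 (2 * n)) 𝓘(ℝ, Model n →L[ℝ] Model n) ∞ K) :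
    ContMDiff (𝓡 (2 * n)) ((𝓡 (2 * n)).prod 𝓘(ℝ, Model n →L[ℝ] Model n)) ∞
    (fun p => Bundle.TotalSpace.mk' (Model n →L[ℝ] Model n)
      (E := fun p : M => TangentSpace (𝓡 (2 * n)) p →L[ℝ] TangentSpace (𝓡 (2 * n)) p) p (K p)) := by
  intro p
  refine (contMDiffAt_hom_bundle _).2 ⟨contMDiffAt_id, (hK p).congr_of_eventuallyEq
    (Eventually.of_forall fun q => ?_)⟩
  change ContinuousLinearMap.inCoordinates (Model n) (TangentSpace (𝓡 (2 * n)) (M := M)) (Model n)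
    (TangentSpace (𝓡 (2 * n)) (M := M)) p q p q (K q) = K q
  ext v : 1
  have h1 := congrArg (fun L : Model n →L[ℝ] Model n => L v) (symmL_of_const_chart hc p q)
  have h2 := congrArg (fun L : Model n →L[ℝ] Model n => L (K q v))
    (continuousLinearMapAt_of_const_chart hc p q)
  refine Eq.trans ?_ h2
  exact congrArg (fun w : Model n => (trivializationAt (Model n) (TangentSpace (𝓡 (2 * n)))
    p).continuousLinearMapAt ℝ q (K q w)) h1

theorem contMDiff_bilinear_of_const_chart
    (hc : ∀ p q : M, chartAt (Model n) p = chartAt (Model n) q)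
    {B : M → Model n →L[ℝ] Model n →L[ℝ] ℝ}
    (hB : ContMDiff (𝓡 (2 * n)) 𝓘(ℝ, Model n →L[ℝ] Model n →L[ℝ] ℝ) ∞ B) :
    ContMDiff (𝓡 (2 * n)) ((𝓡 (2 * n)).prod 𝓘(ℝ, Model n →L[ℝ] Model n →L[ℝ] ℝ)) ∞
    (fun p => Bundle.TotalSpace.mk' (Model n →L[ℝ] Model n →L[ℝ] ℝ)
      (E := fun p : M => TangentSpace (𝓡 (2 * n)) p →L[ℝ] TangentSpace (𝓡 (2 * n)) p →L[ℝ] ℝ)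
      p (B p)) := by
  intro p
  refine (contMDiffAt_hom_bundle _).2 ⟨contMDiffAt_id, (hB p).congr_of_eventuallyEq
    (Eventually.of_forall fun q => ?_)⟩
  change ContinuousLinearMap.inCoordinates (Model n) (TangentSpace (𝓡 (2 * n)) (M := M))
    (Model n →L[ℝ] ℝ) (fun p : M => TangentSpace (𝓡 (2 * n)) p →L[ℝ] ℝ) p q p q (B q) = B q
  ext v w
  have h1 := fun v => congrArg (fun L : Model n →L[ℝ] Model n => L v)
    (symmL_of_const_chart hc p q)
  have hq : q ∈ (trivializationAt (Model n) (TangentSpace (𝓡 (2 * n))) p).baseSet := by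
    rw [TangentBundle.trivializationAt_baseSet, hc p q]
    exact mem_chart_source _ q
  have hq' : q ∈ (trivializationAt (Model n →L[ℝ] ℝ)
      (fun p : M => TangentSpace (𝓡 (2 * n)) p →L[ℝ] ℝ) p).baseSet := ⟨hq, trivial⟩
  have h2 : ∀ f : TangentSpace (𝓡 (2 * n)) q →L[ℝ] ℝ,
      (trivializationAt (Model n →L[ℝ] ℝ)
        (fun p : M => TangentSpace (𝓡 (2 * n)) p →L[ℝ] ℝ) p).continuousLinearMapAt ℝ q f w =
      f (w : Model n) := by
    intro f
    rw [Trivialization.continuousLinearMapAt_apply, Trivialization.linearMapAt_apply, if_pos hq',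
      hom_trivializationAt_apply]
    change ContinuousLinearMap.inCoordinates (Model n) (TangentSpace (𝓡 (2 * n)) (M := M)) ℝ
      (Bundle.Trivial M ℝ) p q p q f w = f w
    rw [ContinuousLinearMap.inCoordinates]
    refine Eq.trans ?_ (congrArg f (h1 w))
    simp
    rfl
  refine Eq.trans (h2 _) ?_
  exact congrArg (fun v' : Model n => B q v' w) (h1 v)

theorem dChart_of_const_chart (hc : ∀ p q : M, chartAt (Model n) p = chartAt (Model n) q)
    (p q : M) (v : TangentSpace (𝓡 (2 * n)) q) : dChart n (chartAt (Model n) p) q v = v := by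
  have hq : q ∈ (chartAt (Model n) p).source := hc p q ▸ mem_chart_source _ q
  have h := mfderiv_chartAt_eq_tangentCoordChange (I := 𝓡 (2 * n)) hq
  exact congrArg (fun L : Model n →L[ℝ] Model n => L v)
    (h.trans (coordChange_of_const_chart hc q p q))

/-- The almost Hermitian structure given in a global chart by a field of coercive bilinear forms
and a constant complex structure. -/
def almostHermitianOfConstChart (hc : ∀ p q : M, chartAt (Model n) p = chartAt (Model n) q)
    {B : M → Model n →L[ℝ] Model n →L[ℝ] ℝ}
    (hB : ContMDiff (𝓡 (2 * n)) 𝓘(ℝ, Model n →L[ℝ] Model n →L[ℝ] ℝ) ∞ B)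
    (hsym : ∀ p v w, B p v w = B p w v) (hpos : ∀ p v, 1 / 2 * ‖v‖ ^ 2 ≤ B p v v)
    {K : Model n →L[ℝ] Model n} (hK : ∀ v, K (K v) = -v)
    (hBK : ∀ p v w, B p (K v) (K w) = B p v w) : AlmostHermitianStructure n M where
  g :=
    { inner := B
      symm := hsym
      pos := fun p v hv => lt_of_lt_of_le
        (mul_pos (by norm_num) (pow_pos ((norm_pos_iff (E := Model n)).2 hv) 2)) (hpos p v)
      isVonNBounded := fun p => by
        -- From ½‖v‖² ≤ B(v, v) < 1 follows ‖v‖ < √2, so radius 2 is enough.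
        have h : {v : Model n | B p v v < 1} ⊆ Metric.ball 0 2 := by
          intro v hv
          have h1 := hpos p v
          have h2 : B p v v < 1 := hv
          rw [mem_ball_zero_iff]
          nlinarith [norm_nonneg v]
        exact (NormedSpace.isVonNBounded_ball ℝ (Model n) 2).subset h
      contMDiff := contMDiff_bilinear_of_const_chart hc hB }
  J := fun _ => K
  contMDiff_J := contMDiff_endomorphism_of_const_chart hc (K := fun _ => K) contMDiff_const
  J_sq := fun _ => hK
  J_isometry := hBK

/-- A constant complex structure in a global chart is integrable. -/
theorem exists_isHolomorphicChart (hc : ∀ p q : M, chartAt (Model n) p = chartAt (Model n) q)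
    (S : AlmostHermitianStructure n M) {K : Model n →L[ℝ] Model n}
    (hS : ∀ p (v : TangentSpace (𝓡 (2 * n)) p), S.J p v = K v)
    (P : M) : ∃ z : OpenPartialHomeomorph M (EuclideanSpace ℂ (Fin n)),
      S.IsHolomorphicChart z ∧ P ∈ z.source := by
  have hfin : Module.finrank ℝ (Model n) = 2 * n := by simp [Model]
  -- The metric at `P` serves only to produce a frame; just its complex linearity is kept, so the
  -- linear coordinates are holomorphic on the whole chart.
  let b : Model n →L[ℝ] Model n →L[ℝ] ℝ := S.g.inner P
  obtain ⟨L₀, hL₀, -⟩ := exists_hermitian_equiv hfin K.toLinearMap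
    (fun X => (congrArg (fun w : Model n => K w) (hS P X)).symm.trans
      ((hS P _).symm.trans (S.J_sq P X)))
    (ContinuousLinearMap.coeLM ℝ ∘ₗ b.toLinearMap) (fun X Y => S.g.symm P X Y)
    (fun X Y => (congrArg₂ (fun v w : Model n => b v w) (hS P X) (hS P Y)).symm.trans
      (S.J_isometry P X Y)) (fun X hX => S.g.pos P X hX)
  let L := L₀.toContinuousLinearEquiv
  have hs := isSmoothChart_chartAt (n := n) P
  let z := (chartAt (Model n) P).trans L.symm.toHomeomorph.toOpenPartialHomeomorph
  have hz : ∀ p ∈ (chartAt (Model n) P).source, ∀ v : TangentSpace (𝓡 (2 * n)) p,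
      dChart n z p v = L.symm v := by
    intro p hp v
    have h1 : HasMFDerivAt 𝓘(ℝ, Model n) 𝓘(ℝ, EuclideanSpace ℂ (Fin n)) L.symm
        (chartAt (Model n) P p) (L.symm : Model n →L[ℝ] EuclideanSpace ℂ (Fin n)) :=
      L.symm.hasFDerivAt.hasMFDerivAt
    have h2 := (h1.comp p (hs.mdifferentiableAt hp).hasMFDerivAt).mfderiv
    refine (congrArg (fun T : Model n →L[ℝ] EuclideanSpace ℂ (Fin n) => T v) h2).trans ?_
    exact congrArg L.symm (dChart_of_const_chart hc P p v)
  refine ⟨z, ⟨?_, ?_, ?_⟩, ⟨mem_chart_source _ P, trivial⟩⟩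
  · exact L.symm.contDiff.contMDiff.comp_contMDiffOn (hs.smooth.mono fun p hp => hp.1)
  · exact hs.smooth_symm.comp L.contDiff.contMDiff.contMDiffOn fun u hu => hu.2
  · intro p hp v
    rw [hz p hp.1, hz p hp.1]
    have h : L (L.symm (K v)) = L (Complex.I • L.symm v) := by
      have h1 := hL₀ (L.symm v)
      have h2 : L₀ (L.symm v) = v := L.apply_symm_apply v
      rw [h2] at h1
      rw [L.apply_symm_apply]
      exact h1.symm
    refine Eq.trans ?_ (L.injective h)
    exact congrArg (fun w : Model n => L.symm w) (hS p v)

end GlobalChart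

/-! ### Currying 4-tensors -/

section Curry

variable {W : Type*}

theorem update_zero (a b c d x : W) : Function.update ![a, b, c, d] 0 x = ![x, b, c, d] := by
  funext i
  fin_cases i <;> rfl

theorem update_one (a b c d x : W) : Function.update ![a, b, c, d] 1 x = ![a, x, c, d] := by
  funext i
  fin_cases i <;> rfl

theorem update_two (a b c d x : W) : Function.update ![a, b, c, d] 2 x = ![a, b, x, d] := by
  funext i
  fin_cases i <;> rfl

theorem update_three (a b c d x : W) : Function.update ![a, b, c, d] 3 x = ![a, b, c, x] := by
  funext i
  fin_cases i <;> rfl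

set_option maxSynthPendingDepth 4 in
/-- A 4-tensor on a finite-dimensional space as an iterated continuous linear map. -/
theorem exists_curry [NormedAddCommGroup W] [InnerProductSpace ℝ W] [FiniteDimensional ℝ W] (Θ : Tensor4 W) :
    ∃ T : W →L[ℝ] W →L[ℝ] W →L[ℝ] W →L[ℝ] ℝ, ∀ a b c d, T c d a b = Θ ![a, b, c, d] := by
  have a0 : ∀ a b c d x, Θ ![a + x, b, c, d] = Θ ![a, b, c, d] + Θ ![x, b, c, d] := by
    intro a b c d x
    simpa only [update_zero] using Θ.map_update_add ![a, b, c, d] 0 a x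
  have a1 : ∀ a b c d x, Θ ![a, b + x, c, d] = Θ ![a, b, c, d] + Θ ![a, x, c, d] := by
    intro a b c d x
    simpa only [update_one] using Θ.map_update_add ![a, b, c, d] 1 b x
  have a2 : ∀ a b c d x, Θ ![a, b, c + x, d] = Θ ![a, b, c, d] + Θ ![a, b, x, d] := by
    intro a b c d x
    simpa only [update_two] using Θ.map_update_add ![a, b, c, d] 2 c x
  have a3 : ∀ a b c d x, Θ ![a, b, c, d + x] = Θ ![a, b, c, d] + Θ ![a, b, c, x] := by
    intro a b c d x
    simpa only [update_three] using Θ.map_update_add ![a, b, c, d] 3 d x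
  have m0 : ∀ (r : ℝ) a b c d, Θ ![r • a, b, c, d] = r • Θ ![a, b, c, d] := by
    intro r a b c d
    simpa only [update_zero] using Θ.map_update_smul ![a, b, c, d] 0 r a
  have m1 : ∀ (r : ℝ) a b c d, Θ ![a, r • b, c, d] = r • Θ ![a, b, c, d] := by
    intro r a b c d
    simpa only [update_one] using Θ.map_update_smul ![a, b, c, d] 1 r b
  have m2 : ∀ (r : ℝ) a b c d, Θ ![a, b, r • c, d] = r • Θ ![a, b, c, d] := by
    intro r a b c d
    simpa only [update_two] using Θ.map_update_smul ![a, b, c, d] 2 r c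
  have m3 : ∀ (r : ℝ) a b c d, Θ ![a, b, c, r • d] = r • Θ ![a, b, c, d] := by
    intro r a b c d
    simpa only [update_three] using Θ.map_update_smul ![a, b, c, d] 3 r d
  let T1 : W → W → W → W →L[ℝ] ℝ := fun c d a => LinearMap.toContinuousLinearMap
    { toFun := fun b => Θ ![a, b, c, d]
      map_add' := fun b x => a1 a b c d x
      map_smul' := fun r b => m1 r a b c d }
  let T2 : W → W → W →L[ℝ] W →L[ℝ] ℝ := fun c d => LinearMap.toContinuousLinearMap
    { toFun := fun a => T1 c d a
      map_add' := fun a x => by ext b; exact a0 a b c d x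
      map_smul' := fun r a => by ext b; exact m0 r a b c d }
  let T3 : W → W →L[ℝ] W →L[ℝ] W →L[ℝ] ℝ := fun c => LinearMap.toContinuousLinearMap
    { toFun := fun d => T2 c d
      map_add' := fun d x => by ext a b; exact a3 a b c d x
      map_smul' := fun r d => by ext a b; exact m3 r a b c d }
  exact ⟨LinearMap.toContinuousLinearMap
    { toFun := fun c => T3 c
      map_add' := fun c x => by ext d a b; exact a2 a b c d x
      map_smul' := fun r c => by ext d a b; exact m2 r a b c d }, fun a b c d => rfl⟩

end Curry

/-! ### Realizing the elements of 𝔏 -/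

section Realization

open Filter Topology

set_option maxSynthPendingDepth 4

universe w

/-- The open ball of radius `r` in the model space, in an arbitrary universe. -/
abbrev ModelBall (n : ℕ) (r : ℝ) : Type w := ULift.{w} (Metric.ball (0 : Model n) r)

theorem isOpenEmbedding_modelBall (n : ℕ) (r : ℝ) :
    IsOpenEmbedding fun x : ModelBall.{w} n r => (x.down : Model n) :=
  Metric.isOpen_ball.isOpenEmbedding_subtypeVal.comp Homeomorph.ulift.isOpenEmbedding

theorem exists_pos_mul_sq_le (C : ℝ) (hC : 0 ≤ C) : ∃ r > 0, C * r ^ 2 ≤ 1 / 2 := by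
  refine ⟨1 / (2 * (C + 1)), by positivity, ?_⟩
  rw [div_pow, one_pow, mul_one_div, div_le_div_iff₀ (by positivity) (by norm_num)]
  nlinarith

/-- On the ball of radius `r` the perturbation T(u, u) uses up at most half of ‖X‖², so adding it to
the inner product keeps the form coercive. -/
theorem abs_apply_le {W : Type*} [NormedAddCommGroup W] [NormedSpace ℝ W]
    (T : W →L[ℝ] W →L[ℝ] W →L[ℝ] W →L[ℝ] ℝ) {r : ℝ} (hT : ‖T‖ * r ^ 2 ≤ 1 / 2) {u : W}
    (hu : ‖u‖ ≤ r) (X : W) : |T u u X X| ≤ 1 / 2 * ‖X‖ ^ 2 := by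
  have h1 : ‖T u‖ ≤ ‖T‖ * ‖u‖ := T.le_opNorm u
  have h2 : ‖T u u‖ ≤ ‖T‖ * ‖u‖ * ‖u‖ :=
    ((T u).le_opNorm u).trans (mul_le_mul_of_nonneg_right h1 (norm_nonneg u))
  have h3 : ‖T u u X‖ ≤ ‖T‖ * ‖u‖ * ‖u‖ * ‖X‖ :=
    ((T u u).le_opNorm X).trans (mul_le_mul_of_nonneg_right h2 (norm_nonneg X))
  have h4 : ‖T u u X X‖ ≤ ‖T‖ * ‖u‖ * ‖u‖ * ‖X‖ * ‖X‖ :=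
    ((T u u X).le_opNorm X).trans (mul_le_mul_of_nonneg_right h3 (norm_nonneg X))
  have h5 : ‖T‖ * ‖u‖ ^ 2 ≤ 1 / 2 :=
    (mul_le_mul_of_nonneg_left (pow_le_pow_left₀ (norm_nonneg u) hu 2) (norm_nonneg T)).trans hT
  rw [← Real.norm_eq_abs]
  calc ‖T u u X X‖ ≤ ‖T‖ * ‖u‖ ^ 2 * ‖X‖ ^ 2 := by linarith
    _ ≤ 1 / 2 * ‖X‖ ^ 2 := mul_le_mul_of_nonneg_right h5 (sq_nonneg _)

variable {V : Type*} [NormedAddCommGroup V] [InnerProductSpace ℝ V]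

/-- A Hermitian metric near the origin, with prescribed Hessian at the origin. -/
theorem exists_metric_of_mem_symPlusTensorSym {W : Type*} [NormedAddCommGroup W]
    [InnerProductSpace ℝ W] [FiniteDimensional ℝ W] (φ : V ≃ₗᵢ[ℝ] W)
    {J : HermitianComplexStructure V} {Θ : Tensor4 V} (hΘ : Θ ∈ symPlusTensorSym J) {K : W →L[ℝ] W}
    (hK : ∀ X, K X = φ (J.J (φ.symm X))) :
    ∃ G : W → W →L[ℝ] W →L[ℝ] ℝ, ∃ r > 0, ContDiff ℝ ∞ G ∧ (∀ u X Y, G u X Y = G u Y X) ∧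
      (∀ u X Y, G u (K X) (K Y) = G u X Y) ∧
      (∀ u ∈ Metric.ball (0 : W) r, ∀ X, 1 / 2 * ‖X‖ ^ 2 ≤ G u X X) ∧
      (∀ X Y, G 0 X Y = inner ℝ X Y) ∧ fderiv ℝ G 0 = 0 ∧
      ∀ a b c d, fderiv ℝ (fderiv ℝ G) 0 (φ c) (φ d) (φ a) (φ b) = 2 * Θ ![a, b, c, d] := by
  obtain ⟨hΘ1, hΘ2, hΘ3⟩ := hΘ
  obtain ⟨T, hT⟩ := exists_curry
    (Θ.compLinearMap fun _ => φ.symm.toLinearEquiv.toLinearMap : Tensor4 W)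
  have hT' : ∀ a b c d, T c d a b = Θ ![φ.symm a, φ.symm b, φ.symm c, φ.symm d] := by
    intro a b c d
    rw [hT, MultilinearMap.compLinearMap_apply]
    congr 1
    funext i
    fin_cases i <;> rfl
  have hTs : ∀ c d, ((2 : ℝ) • T) c d = ((2 : ℝ) • T) d c := by
    intro c d
    ext a b
    simp only [smul_apply, hT', hΘ3]
  obtain ⟨r, hr, hTr⟩ := exists_pos_mul_sq_le ‖T‖ (norm_nonneg _)
  have happ : ∀ u X Y, quadraticMap (innerSL ℝ) 0 ((2 : ℝ) • T) u X Y =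
      inner ℝ X Y + T u u X Y := by
    intro u X Y
    simp [quadraticMap]
  -- No linear term makes 0 a critical point; the coefficient 2 offsets the ½ in `quadraticMap`, so
  -- the form at `u` is ⟨X, Y⟩ + T(u, u, X, Y).
  refine ⟨quadraticMap (innerSL ℝ) 0 ((2 : ℝ) • T), r, hr, contDiff_quadraticMap _ _ _, ?_, ?_, ?_,
    ?_, ?_, ?_⟩
  · intro u X Y
    rw [happ, happ, hT', hT', hΘ1, real_inner_comm]
  · intro u X Y
    rw [happ, happ, hT', hT', hK, hK, φ.symm_apply_apply, φ.symm_apply_apply, hΘ2,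
      φ.inner_map_map, J.isometry, φ.symm.inner_map_map]
  · intro u hu X
    rw [happ, real_inner_self_eq_norm_sq]
    have h := neg_le_of_abs_le (abs_apply_le T hTr (mem_ball_zero_iff.1 hu).le X)
    linarith
  · intro X Y
    rw [happ]
    simp
  · rw [fderiv_quadraticMap _ _ hTs]
    simp
  · intro a b c d
    rw [fderiv_fderiv_quadraticMap _ _ hTs]
    simp only [smul_apply, hT', φ.symm_apply_apply, smul_eq_mul]

/-- A ball with a Hermitian metric that is given in linear coordinates. -/
theorem exists_hermitianStructure_modelBall {n : ℕ} {G : Model n → Model n →L[ℝ] Model n →L[ℝ] ℝ}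
    {K : Model n →L[ℝ] Model n} {r : ℝ} (hr : 0 < r) (hG : ContDiff ℝ ∞ G)
    (hGsym : ∀ u X Y, G u X Y = G u Y X) (hGK : ∀ u X Y, G u (K X) (K Y) = G u X Y)
    (hGpos : ∀ u ∈ Metric.ball (0 : Model n) r, ∀ X, 1 / 2 * ‖X‖ ^ 2 ≤ G u X X)
    (hK : ∀ X, K (K X) = -X) (hG1 : fderiv ℝ G 0 = 0) :
    ∃ (M : Type w) (_ : TopologicalSpace M) (_ : T2Space M) (_ : SecondCountableTopology M)
      (_ : ChartedSpace (Model n) M) (_ : IsManifold (𝓡 (2 * n)) ∞ M)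
      (S : HermitianStructure n M) (P : M), S.dKahler P = 0 ∧
      (∀ X Y : Model n, S.g.inner P X Y = G 0 X Y) ∧ (∀ X : Model n, S.J P X = K X) ∧
      ∀ X Y Z W : Model n, S.riemann P X Y Z W = curvatureTensor G 0 X Y Z W := by
  have hf := isOpenEmbedding_modelBall.{w} n r
  let P : ModelBall.{w} n r := ⟨⟨0, Metric.mem_ball_self hr⟩⟩
  have : Nonempty (ModelBall.{w} n r) := ⟨P⟩
  -- The inclusion of the ball is the only chart, so `G` and `K` are literally the metric and the
  -- complex structure.
  let _ : ChartedSpace (Model n) (ModelBall.{w} n r) := hf.singletonChartedSpace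
  have : IsManifold (𝓡 (2 * n)) ∞ (ModelBall.{w} n r) := hf.isManifold_singleton
  have hc : ∀ p q : ModelBall.{w} n r, chartAt (Model n) p = chartAt (Model n) q :=
    fun _ _ => rfl
  have hs := isSmoothChart_chartAt (n := n) P
  have hsrc : (chartAt (Model n) P).source = Set.univ :=
    Set.eq_univ_of_forall fun p => hc p P ▸ mem_chart_source _ p
  have hsm : ContMDiff (𝓡 (2 * n)) 𝓘(ℝ, Model n) ∞
      fun p : ModelBall.{w} n r => (p.down : Model n) := by
    have h := hs.smooth
    rw [hsrc] at h
    exact contMDiffOn_univ.1 h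
  have hB : ContMDiff (𝓡 (2 * n)) 𝓘(ℝ, Model n →L[ℝ] Model n →L[ℝ] ℝ) ∞
      fun p : ModelBall.{w} n r => G p.down := hG.contMDiff.comp hsm
  let S₀ := almostHermitianOfConstChart hc hB (fun p => hGsym _)
    (fun p => hGpos _ p.down.2) hK (fun p => hGK _)
  let S : HermitianStructure n (ModelBall.{w} n r) :=
    ⟨S₀, exists_isHolomorphicChart hc S₀ (K := K) fun _ _ => rfl⟩
  have hPs : P ∈ (chartAt (Model n) P).source := mem_chart_source _ P
  have hP0 : chartAt (Model n) P P = 0 := rfl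
  have hPt : (0 : Model n) ∈ (chartAt (Model n) P).target := (chartAt (Model n) P).map_source hPs
  have hmet : S.metricIn (chartAt (Model n) P) =ᶠ[𝓝 0] G := by
    filter_upwards [(chartAt (Model n) P).open_target.mem_nhds hPt] with u hu
    have hd : ∀ X : Model n, (dSymm n (chartAt (Model n) P) u X : Model n) = X := by
      intro X
      have h := hs.dChart_dSymm hu X
      exact (dChart_of_const_chart hc P _ _).symm.trans h
    have hu' : (((chartAt (Model n) P).symm u).down : Model n) = u :=
      (chartAt (Model n) P).right_inv hu
    ext X Y
    rw [AlmostHermitianStructure.metricIn_apply]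
    refine (congrArg₂ (fun a b : Model n => G ((chartAt (Model n) P).symm u).down a b)
      (hd X) (hd Y)).trans ?_
    rw [hu']
  have hJ : ∀ p ∈ (chartAt (Model n) P).source, ∀ v : TangentSpace (𝓡 (2 * n)) p,
      dChart n (chartAt (Model n) P) p (S.J p v) = K (dChart n (chartAt (Model n) P) p v) := by
    intro p _ v
    refine (dChart_of_const_chart hc P p _).trans ?_
    exact congrArg (fun w : Model n => K w) (dChart_of_const_chart hc P p v).symm
  refine ⟨ModelBall.{w} n r, inferInstance, inferInstance, hf.isEmbedding.secondCountableTopology,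
    inferInstance, inferInstance, S, P, ?_, fun X Y => rfl, fun X => rfl, ?_⟩
  · rw [S.dKahler_eq_zero_iff hs hJ hPs, hP0, hmet.fderiv_eq, hG1]
    simp
  · intro X Y Z W
    have hd : ∀ X : Model n, dChart n (chartAt (Model n) P) P X = X :=
      fun X => dChart_of_const_chart hc P P X
    refine (S.riemann_eq hs hPs X Y Z W).trans ?_
    rw [hP0, curvatureTensor_congr hmet]
    exact congr (congr (congr (congrArg (curvatureTensor G 0) (hd X)) (hd Y)) (hd Z)) (hd W)

/-- Every element of the range of `ℒ` is the curvature of a Hermitian manifold at a point at which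
the Kähler form is closed. -/
theorem exists_realizes_of_mem_curvRange [FiniteDimensional ℝ V] {n : ℕ}
    (hn : Module.finrank ℝ V = 2 * n) (J : HermitianComplexStructure V) {A : algCurv V}
    (hA : A ∈ curvRange J) :
    ∃ (M : Type w) (_ : TopologicalSpace M) (_ : T2Space M) (_ : SecondCountableTopology M)
      (_ : ChartedSpace (Model n) M) (_ : IsManifold (𝓡 (2 * n)) ∞ M)
      (S : HermitianStructure n M) (P : M), S.dKahler P = 0 ∧ S.Realizes P J A := by
  obtain ⟨Θ, hΘ, hΘA⟩ := (mem_curvRange_iff J A).1 hA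
  let φ : V ≃ₗᵢ[ℝ] Model n := ((stdOrthonormalBasis ℝ V).reindex (finCongr hn)).repr
  let K : Model n →L[ℝ] Model n := LinearMap.toContinuousLinearMap
    (φ.toLinearEquiv.toLinearMap ∘ₗ J.J ∘ₗ φ.symm.toLinearEquiv.toLinearMap)
  have hKφ : ∀ X, K X = φ (J.J (φ.symm X)) := fun X => rfl
  have hK : ∀ X, K (K X) = -X := by
    intro X
    rw [hKφ, hKφ, φ.symm_apply_apply, J.sq, map_neg, φ.apply_symm_apply]
  obtain ⟨G, r, hr, hG, hGsym, hGK, hGpos, hG0, hG1, hG2⟩ :=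
    exists_metric_of_mem_symPlusTensorSym φ hΘ hKφ
  obtain ⟨M, i₁, i₂, i₃, i₄, i₅, S, P, hdK, hg, hJ, hR⟩ :=
    exists_hermitianStructure_modelBall.{w} hr hG hGsym hGK hGpos hK hG1
  refine ⟨M, i₁, i₂, i₃, i₄, i₅, S, P, hdK, φ.toLinearEquiv, ?_, ?_, ?_⟩
  · intro x y
    refine Eq.trans ?_ (hg (φ x) (φ y)).symm
    rw [hG0, φ.inner_map_map]
  · intro x
    refine Eq.trans ?_ (hJ (φ x)).symm
    rw [hKφ, φ.symm_apply_apply]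
    rfl
  · intro x y z w
    have hinv : (G 0).IsInvertible := by
      refine isInvertible_of_pos _ fun X hX => ?_
      rw [hG0]
      exact real_inner_self_pos.2 hX
    refine Eq.trans ?_ (hR (φ x) (φ y) (φ z) (φ w)).symm
    rw [curvatureTensor_of_fderiv_eq_zero (hG.contDiffAt.of_le ENat.LEInfty.out) hinv hG1]
    -- The Hessian is 2Θ, which cancels the ½ of the curvature formula.
    simp only [hG2, hΘA]
    ring

end Realization

end HermitianCurvature

end

theorem lemma2p3 (n : ℕ) :
    (∀ (M : Type*) [TopologicalSpace M] [ChartedSpace (HermitianCurvature.Model n) M]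
      [IsManifold (𝓡 (2 * n)) ∞ M] (S : HermitianCurvature.HermitianStructure n M) (P : M),
      S.dKahler P = 0 ↔
        ∃ z : OpenPartialHomeomorph M (EuclideanSpace ℂ (Fin n)),
          S.IsHolomorphicChart z ∧ P ∈ z.source ∧ z P = 0 ∧
          ∀ ξ η : EuclideanSpace ℂ (Fin n),
            (fun u : EuclideanSpace ℂ (Fin n) =>
              S.metricIn z u ξ η - ∑ a, ((starRingEnd ℂ) (ξ a) * η a).re)
              =O[𝓝 0] (fun u => ‖u‖ ^ 2)) ∧
    (∀ (V : Type*) [NormedAddCommGroup V] [InnerProductSpace ℝ V] [FiniteDimensional ℝ V],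
      Module.finrank ℝ V = 2 * n →
      ∀ (J : HermitianCurvature.HermitianComplexStructure V) (A : HermitianCurvature.algCurv V),
      A ∈ HermitianCurvature.curvRange J ↔
        ∃ (M : Type*) (_ : TopologicalSpace M) (_ : T2Space M) (_ : SecondCountableTopology M)
          (_ : ChartedSpace (HermitianCurvature.Model n) M) (_ : IsManifold (𝓡 (2 * n)) ∞ M)
          (S : HermitianCurvature.HermitianStructure n M) (P : M),
          S.dKahler P = 0 ∧ S.Realizes P J A) := by
  refine ⟨fun M _ _ _ S P => ⟨fun h => S.exists_isOsculating h, ?_⟩,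
    fun V _ _ _ hn J A => ⟨fun h => ?_, ?_⟩⟩
  · rintro ⟨z, hz⟩
    exact HermitianCurvature.AlmostHermitianStructure.IsOsculating.dKahler_eq_zero hz
  · exact HermitianCurvature.exists_realizes_of_mem_curvRange hn J h
  · rintro ⟨M, _, _, _, _, _, S, P, hP, h⟩
    exact HermitianCurvature.mem_curvRange_of_realizes S hP J h
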